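/- **Notation.** For an $m\times m$ complex Hermitian matrix $A$ let $\lambda_1(A)\ge\dots\ge\lambda_m(A)$ be its eigenvalues, counted with multiplicity, and let $$\mathrm{Spr}^+(A)=\big(\lambda_i(A)-\lambda_{m-i+1}(A)\big)_{1\le i\le \lfloor m/2\rfloor}.$$ For an $n\times n$ complex matrix $B$ let $s(B)=(s_1(B)\ge\dots\ge s_n(B))$ be the vector of its singular values. For $x,y\in\mathbb R^k$, $x\prec_w y$ means that for every $1\le j\le k$ the sum of the $j$ largest entries of $x$ is at most the sum of the $j$ largest entries of $y$; for vectors with non-negative entries and of different sizes, the shorter one is first completed with zeros. Products of vectors are taken entrywise, up to the smaller of the two sizes, and $A_1\oplus A_2$ is the block diagonal matrix with blocks $A_1,A_2$. For subspaces $\mathcal S,\mathcal T\subseteq\mathbb C^n$ of the same dimension $k$, $\Theta(\mathcal S,\mathcal T)=(\theta_1\ge\dots\ge\theta_k)\in[0,\pi/2]^k$ is the vector of principal angles: $\cos\theta_j=s_{k-j+1}(S^*T)$, where $S,T$ are $n\times k$ isometries with ranges $\mathcal S,\mathcal T$. **Theorem.** The following five statements are equivalent. 1. For all $n$ and all Hermitian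 $n\times n$ matrices $A_1,A_2$: $\; s(A_1-A_2)\prec_w \mathrm{Spr}^+(A_1\oplus A_2)$. 2. For all $n$ and all Hermitian $2n\times 2n$ matrices $A=\begin{pmatrix}A_1&B\\B^*&A_2\end{pmatrix}$ with $n\times n$ blocks: $\; 2\,s(B)\prec_w \mathrm{Spr}^+(A)$. 3. For all $n$, all Hermitian $n\times n$ matrices $A_1,A_2$ and all complex $n\times n$ matrices $X$: $\; s(A_1X-XA_2)\prec_w s(X)\,\mathrm{Spr}^+(A_1\oplus A_2)$. 4. For all $n$ and all Hermitian $n\times n$ matrices $A,X$, with $U=e^{iX}$: $\; s(A-U^*AU)\prec_w s(X)\,\mathrm{Spr}^+(A\oplus A)$. 5. For all $n$, all subspaces $\mathcal S,\mathcal T\subseteq\mathbb C^n$ and all Hermitian $n\times n$ matrices $X$ with $e^{iX}\mathcal S=\mathcal T$: $\;\Theta(\mathcal S,\mathcal T)\prec_w \tfrac12\,\mathrm{Spr}^+(X)$. -/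

import Mathlib

open scoped Matrix

noncomputable section

namespace SpectralSpread

/-! Vectors of `ℝ^k` are functions `Fin k → ℝ`, with 0-based indices. -/

/-- The decreasing rearrangement of a real vector
(`Tuple.sort x` is a permutation that makes `x` non-decreasing; the result is then reversed). -/
def decreasing {k : ℕ} (x : Fin k → ℝ) : Fin k → ℝ :=
  fun i => x (Tuple.sort x i.rev)

/-- The vector of size `m` obtained from `x` by appending zeros at the end
(it is only used for `k ≤ m`). -/
def padZero {k : ℕ} (m : ℕ) (x : Fin k → ℝ) : Fin m → ℝ :=
  fun i => if h : (i : ℕ) < k then x ⟨i, h⟩ else 0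

/-- Submajorization `x ≺_w y`: for every `j`, the sum of the `j` largest entries of `x` is at most
the sum of the `j` largest entries of `y`. If the sizes differ, then the shorter vector is first
completed with zeros (as usual, this is meant for vectors with non-negative entries). For `k = h`
the completion with zeros changes nothing. -/
def Submajorized {k h : ℕ} (x : Fin k → ℝ) (y : Fin h → ℝ) : Prop :=
  ∀ (j : ℕ) (hj : j ≤ max k h),
    ∑ i : Fin j, decreasing (padZero (max k h) x) (i.castLE hj) ≤
      ∑ i : Fin j, decreasing (padZero (max k h) y) (i.castLE hj)

/-- The entrywise product of vectors of possibly different sizes `k`, `r`: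
a vector of size `min k r`. -/
def entrywiseMul {k r : ℕ} (x : Fin k → ℝ) (y : Fin r → ℝ) : Fin (min k r) → ℝ :=
  fun i => x (i.castLE (min_le_left k r)) * y (i.castLE (min_le_right k r))

section Matrices

variable {ι κ : Type*} [Fintype ι] [DecidableEq ι] [Fintype κ] [DecidableEq κ]

/-- The vector `s(B)` of singular values of a matrix, in non-increasing order and with
multiplicities; its size is the number of columns of `B`. -/
def singVals (B : Matrix ι κ ℂ) : Fin (Fintype.card κ) → ℝ :=
  fun i => (Matrix.toEuclideanLin B).singularValues i

/-- The full spectral spread `Spr(A) = (λ_i(A) - λ_i^↑(A))_i` of a Hermitian matrix, where `λ(A)`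
is the non-increasing and `λ^↑(A)` the non-decreasing vector of the eigenvalues, counted with
multiplicities. -/
def spr {A : Matrix ι ι ℂ} (hA : A.IsHermitian) : Fin (Fintype.card ι) → ℝ :=
  fun i => hA.eigenvalues₀ i - hA.eigenvalues₀ i.rev

/-- The spectral spread `Spr⁺(A)`: the first `⌊n / 2⌋` entries of `Spr(A)`,
for an `n × n` Hermitian matrix `A`. -/
def sprPos {A : Matrix ι ι ℂ} (hA : A.IsHermitian) : Fin (Fintype.card ι / 2) → ℝ :=
  fun i => spr hA (i.castLE (Nat.div_le_self _ 2))

/-- The direct sum `A₁ ⊕ A₂`, as a block diagonal matrix. -/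
def directSum (A₁ : Matrix ι ι ℂ) (A₂ : Matrix κ κ ℂ) : Matrix (ι ⊕ κ) (ι ⊕ κ) ℂ :=
  Matrix.fromBlocks A₁ 0 0 A₂

/-- The unitary matrix `e^{iX}`, for a Hermitian matrix `X`. -/
def expI (X : Matrix ι ι ℂ) : Matrix ι ι ℂ :=
  NormedSpace.exp (Complex.I • X)

end Matrices

theorem directSum_isHermitian {ι κ : Type*} {A₁ : Matrix ι ι ℂ} {A₂ : Matrix κ κ ℂ}
    (h₁ : A₁.IsHermitian) (h₂ : A₂.IsHermitian) : (directSum A₁ A₂).IsHermitian :=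
  Matrix.IsHermitian.fromBlocks h₁ (by simp) h₂

/-- The vector `Θ(S, T)` of principal angles between two subspaces of `ℂ^n` of the same dimension
`k`, in non-increasing order: `cos θ_j = s_{k-j+1}(V^* W)` for `j = 1, …, k`, where `V`, `W` are
isometries with ranges `S`, `T` (here the inclusion maps of the two subspaces). -/
def principalAngles {n : ℕ} (S T : Submodule ℂ (EuclideanSpace ℂ (Fin n))) :
    Fin (Module.finrank ℂ S) → ℝ :=
  fun j => Real.arccos
    (LinearMap.singularValues (𝕜 := ℂ) (E := T) (F := S)
      (LinearMap.adjoint (𝕜 := ℂ) (E := S) (F := EuclideanSpace ℂ (Fin n)) S.subtype ∘ₗ T.subtype)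
      (j.rev : ℕ))

end SpectralSpread

end

/-! All five statements are true, and the equivalence follows from proving each of them separately.
The common source is a Ky Fan type inequality. Let `f`, `g` be families of `j` vectors that satisfy
Bessel's inequality and have equal total squared norm. In an eigenbasis of a Hermitian `A`, the
difference of the traces of `A` along `f` and `g` is `∑ λ_l (a_l - b_l)` with weights in `[0, 1]` of
equal total mass at most `j`. Such a sum is largest when `a` sits on the top and `b` on the bottom
eigenvalues, which gives the sum of the first `j` entries of the spread (`sum_re_inner_sub_le`).
Bessel families replace orthonormal ones because contractions preserve them.

Sums of singular values of `M` are sums `∑ Re ⟨u_i, M v_i⟩` over Bessel families, so it suffices to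
bound the latter. Off-diagonal blocks use the families `(u, v)/√2` and `(u, -v)/√2`. For `A₁X - XA₂`
with a contraction `X`, the families `(u ± Xv, v ∓ X*u)/2` work, and `X = 1` gives differences. A
general `X` is expanded by its singular value decomposition. Its truncations with unit weights are
contractions, and Abel summation restores the singular values.

The last two statements are integrated infinitesimal inequalities along `t ↦ e^{itX}`. For
conjugates, the derivative of `∑ Re ⟨V_t u, A V_t v⟩` is a commutator sum. For angles, let `R` be
the reflection fixing `S`. Its compression to `T` has the eigenvalues `cos 2θ`. Moving `R` by `V_t R
V_{-t}` makes this compression the identity at `t = 1`, where all angles vanish, and the rate of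
change of `∑ θ` is controlled by half the spread of `X`. Since `arccos` is singular at `±1`, it is
replaced by `v ↦ arccos (r v)` with `r < 1`. A Peierls inequality then compares eigenvalues at
nearby times without differentiating eigenvectors, and finally `r → 1`. -/

noncomputable section

namespace SpectralSpread

/-! ### Submajorization and weighted sums of real vectors -/

/-- The sum of the entries of `y` with index below `j`. -/
def prefixSum {h : ℕ} (j : ℕ) (y : Fin h → ℝ) : ℝ :=
  ∑ i : Fin h, if (i : ℕ) < j then y i else 0

theorem prefixSum_mono {h : ℕ} {y : Fin h → ℝ} (hy : ∀ i, 0 ≤ y i) {j k : ℕ} (hjk : j ≤ k) :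
    prefixSum j y ≤ prefixSum k y := by
  refine Finset.sum_le_sum fun i _ => ?_
  split_ifs with h1 h2
  · exact le_rfl
  · omega
  · exact hy i
  · exact le_rfl

theorem prefixSum_smul {h : ℕ} (y : Fin h → ℝ) (c : ℝ) (j : ℕ) :
    prefixSum j (c • y) = c * prefixSum j y := by
  simp only [prefixSum, Finset.mul_sum, Pi.smul_apply, smul_eq_mul, mul_ite, mul_zero]

theorem decreasing_of_antitone {k : ℕ} {x : Fin k → ℝ} (hx : Antitone x) : decreasing x = x := by
  have h1 : Monotone (x ∘ Fin.revPerm) := fun a b hab => hx (Fin.rev_le_rev.mpr hab)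
  have h2 := Tuple.unique_monotone h1 (Tuple.monotone_sort x)
  funext i
  have := congrFun h2 i.rev
  simp only [Function.comp_apply, Fin.revPerm_apply, Fin.rev_rev] at this
  exact this.symm

theorem antitone_padZero {k : ℕ} {y : Fin k → ℝ} (hy : Antitone y) (h0 : ∀ i, 0 ≤ y i) (m : ℕ) :
    Antitone (padZero m y) := by
  intro a b hab
  simp only [padZero]
  have hab' : (a : ℕ) ≤ b := hab
  split_ifs with h1 h2
  · exact hy hab'
  · omega
  · exact h0 _
  · exact le_rfl

/-- A sum over `Fin m` of a vector vanishing from `k` on is a sum over `Fin k`. -/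
theorem sum_fin_castLE {k m : ℕ} (hkm : k ≤ m) (g : Fin m → ℝ)
    (hg : ∀ i : Fin m, k ≤ (i : ℕ) → g i = 0) :
    ∑ i, g i = ∑ i : Fin k, g (i.castLE hkm) := by
  symm
  refine Finset.sum_of_injOn (Fin.castLE hkm) ?_ ?_ ?_ ?_
  · exact (Fin.castLE_injective hkm).injOn
  · simp
  · intro i _ hi
    apply hg
    by_contra! hc
    exact hi ⟨⟨i, hc⟩, by simp, by ext; simp⟩
  · simp

theorem sum_ite_mem_univ {α : Type*} [Fintype α] [DecidableEq α] (s : Finset α) (f : α → ℝ) :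
    ∑ i, (if i ∈ s then f i else 0) = ∑ i ∈ s, f i := by
  rw [Finset.sum_ite_mem, Finset.univ_inter]

/-- The `j` largest entries of the padded `x` are the entries over some index set, together with
padding zeros. This removes sorting and padding from all later arguments. -/
theorem submajorized_of_finset {k h : ℕ} {x : Fin k → ℝ} {y : Fin h → ℝ} (hy : Antitone y)
    (hy0 : ∀ i, 0 ≤ y i) (H : ∀ s : Finset (Fin k), ∑ i ∈ s, x i ≤ prefixSum s.card y) :
    Submajorized x y := by
  intro j hj
  set M := max k h with hM
  have hkM : k ≤ M := le_max_left _ _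
  have hhM : h ≤ M := le_max_right _ _
  let e : Fin j ↪ Fin M :=
    ⟨fun i => Tuple.sort (padZero M x) (i.castLE hj).rev, fun a b hab => by
      have := (Tuple.sort (padZero M x)).injective hab
      exact Fin.castLE_injective hj (Fin.rev_injective this)⟩
  let S : Finset (Fin M) := Finset.univ.map e
  have hS : S.card = j := by simp [S]
  let s : Finset (Fin k) := Finset.univ.filter fun i => i.castLE hkM ∈ S
  -- Only an inequality: some of the `j` chosen positions may be padding. `prefixSum_mono` absorbs
  -- the difference at the end.
  have hs : s.card ≤ j := by
    rw [← hS]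
    refine Finset.card_le_card_of_injOn (Fin.castLE hkM) ?_ (Fin.castLE_injective hkM).injOn
    intro i hi
    simpa [s] using hi
  have h1 : ∑ i : Fin j, decreasing (padZero M x) (i.castLE hj) = ∑ i ∈ s, x i := by
    have h2 : ∑ i : Fin j, decreasing (padZero M x) (i.castLE hj) = ∑ i ∈ S, padZero M x i := by
      simp only [S, Finset.sum_map]
      rfl
    rw [h2, ← sum_ite_mem_univ S, Finset.sum_filter,
      sum_fin_castLE hkM]
    · refine Finset.sum_congr rfl fun i _ => ?_
      simp [padZero]
    · intro i hi
      simp [padZero, not_lt.mpr hi]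
  have h2 : ∑ i : Fin j, decreasing (padZero M y) (i.castLE hj) = prefixSum j y := by
    rw [decreasing_of_antitone (antitone_padZero hy hy0 M)]
    have h3 := sum_fin_castLE hj (fun i => if (i : ℕ) < j then padZero M y i else 0)
      (fun i hi => if_neg (not_lt.mpr hi))
    have h4 := sum_fin_castLE hhM (fun i => if (i : ℕ) < j then padZero M y i else 0)
      (fun i hi => by simp [padZero, not_lt.mpr hi])
    simp only [Fin.val_castLE, Fin.is_lt, if_true] at h3
    rw [← h3, h4, prefixSum]
    simp [padZero]
  rw [h1, h2]
  exact (H s).trans (prefixSum_mono hy0 hs)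

/-- A linear functional on weights in `[0, 1]` is largest at an indicator function. -/
theorem exists_finset_sum_mul_le {k j : ℕ} (a d : Fin k → ℝ) (hd0 : ∀ i, 0 ≤ d i)
    (hd1 : ∀ i, d i ≤ 1) (hd : ∑ i, d i = j) :
    ∃ s : Finset (Fin k), s.card = j ∧ ∑ i, d i * a i ≤ ∑ i ∈ s, a i := by
  have hjk : j ≤ k := by
    have : ∑ i, d i ≤ ∑ _i : Fin k, (1 : ℝ) := Finset.sum_le_sum fun i _ => hd1 i
    rw [hd] at this
    simpa using this
  have hne : (Finset.powersetCard j (Finset.univ : Finset (Fin k))).Nonempty :=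
    Finset.powersetCard_nonempty.mpr (by simpa using hjk)
  obtain ⟨s, hs, hmax⟩ := Finset.exists_max_image _ (fun s => ∑ i ∈ s, a i) hne
  rw [Finset.mem_powersetCard] at hs
  have hswap : ∀ i ∈ s, ∀ l ∉ s, a l ≤ a i := by
    intro i hi l hl
    have hl' : l ∉ s.erase i := fun h => hl (Finset.mem_of_mem_erase h)
    have h1 := hmax (insert l (s.erase i)) (by
      rw [Finset.mem_powersetCard]
      refine ⟨Finset.subset_univ _, ?_⟩
      rw [Finset.card_insert_of_notMem hl', Finset.card_erase_add_one hi, hs.2])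
    rw [Finset.sum_insert hl', ← Finset.add_sum_erase s a hi] at h1
    linarith
  refine ⟨s, hs.2, ?_⟩
  -- A threshold separating the values on `s` from those off `s`. If `s` is empty there is no such
  -- value to take, but then all weights vanish.
  obtain ⟨α, h1, h2⟩ : ∃ α, (∀ i ∈ s, α ≤ a i) ∧ ∀ l ∉ s, a l ≤ α ∨ d l = 0 := by
    rcases s.eq_empty_or_nonempty with h | h
    · refine ⟨0, by simp [h], fun l _ => Or.inr ?_⟩
      have : (j : ℝ) = 0 := by rw [← hs.2, h]; simp
      rw [this] at hd
      exact (Finset.sum_eq_zero_iff_of_nonneg fun i _ => hd0 i).mp hd l (Finset.mem_univ _)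
    · obtain ⟨i, hi, hmin⟩ := Finset.exists_min_image s a h
      exact ⟨a i, hmin, fun l hl => Or.inl (hswap i hi l hl)⟩
  -- The two factors never have opposite signs: on `s` both are non-negative, off `s` both are
  -- non-positive or the weight is zero.
  have h3 : 0 ≤ ∑ i, ((if i ∈ s then 1 else 0) - d i) * (a i - α) := by
    refine Finset.sum_nonneg fun i _ => ?_
    split_ifs with hi
    · exact mul_nonneg (by linarith [hd1 i]) (by linarith [h1 i hi])
    · rcases h2 i hi with h | h
      · nlinarith [hd0 i]
      · simp [h]
  have h4 : ∑ i, ((if i ∈ s then 1 else 0) - d i) * (a i - α)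
      = ∑ i ∈ s, a i - ∑ i, d i * a i - α * (∑ i : Fin k, (if i ∈ s then 1 else 0) - ∑ i, d i) := by
    rw [← sum_ite_mem_univ s, ← Finset.sum_sub_distrib, ← Finset.sum_sub_distrib,
      Finset.mul_sum, ← Finset.sum_sub_distrib]
    refine Finset.sum_congr rfl fun i _ => ?_
    split_ifs <;> ring
  have h5 : ∑ i : Fin k, (if i ∈ s then (1 : ℝ) else 0) = j := by simp [hs.2]
  rw [h4, h5, hd] at h3
  linarith

/-- Sums of the first entries of the spread of a non-increasing vector as weighted sums. -/
theorem prefixSum_spread_eq {m j : ℕ} (lam : Fin m → ℝ) :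
    prefixSum j (fun i : Fin (m / 2) => lam (i.castLE (Nat.div_le_self _ 2)) -
      lam (i.castLE (Nat.div_le_self _ 2)).rev) =
    ∑ i : Fin m, lam i * ((if (i : ℕ) < min j (m / 2) then 1 else 0) -
      (if m - min j (m / 2) ≤ (i : ℕ) then 1 else 0)) := by
  have h1 := sum_fin_castLE (Nat.div_le_self m 2)
    (fun i => if (i : ℕ) < min j (m / 2) then lam i - lam i.rev else 0)
    (fun i hi => if_neg (by omega))
  have h2 : ∑ i : Fin m, (if (i : ℕ) < min j (m / 2) then lam i.rev else 0) =
      ∑ i : Fin m, (if m - min j (m / 2) ≤ (i : ℕ) then lam i else 0) := by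
    rw [← Equiv.sum_comp Fin.revPerm]
    refine Finset.sum_congr rfl fun i _ => ?_
    have : ((i.rev : ℕ) < min j (m / 2)) ↔ m - min j (m / 2) ≤ (i : ℕ) := by
      rw [Fin.val_rev]; omega
    simp only [Fin.revPerm_apply, Fin.rev_rev, this]
  simp only [mul_sub, Finset.sum_sub_distrib, mul_ite, mul_one, mul_zero]
  rw [← h2, ← Finset.sum_sub_distrib, prefixSum]
  trans ∑ i : Fin m, (if (i : ℕ) < min j (m / 2) then lam i - lam i.rev else 0)
  · rw [h1]
    refine Finset.sum_congr rfl fun i _ => ?_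
    have : ((i : ℕ) < j) ↔ ((i.castLE (Nat.div_le_self m 2) : Fin m) : ℕ) < min j (m / 2) := by
      have := i.2
      simp only [Fin.val_castLE]; omega
    simp only [this]
  · refine Finset.sum_congr rfl fun i _ => ?_
    split_ifs <;> simp

theorem sum_ite_lt {m q : ℕ} (hq : q ≤ m) :
    ∑ i : Fin m, (if (i : ℕ) < q then (1 : ℝ) else 0) = q := by
  rw [sum_fin_castLE hq _ fun i hi => if_neg (not_lt.mpr hi)]
  simp

theorem sum_ite_ge {m q : ℕ} (hq : q ≤ m) :
    ∑ i : Fin m, (if m - q ≤ (i : ℕ) then (1 : ℝ) else 0) = q := by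
  rw [← sum_ite_lt hq, ← Equiv.sum_comp Fin.revPerm]
  refine Finset.sum_congr rfl fun i _ => ?_
  have : m - q ≤ (i.rev : ℕ) ↔ (i : ℕ) < q := by rw [Fin.val_rev]; omega
  simp only [Fin.revPerm_apply, this]

/-- A bathtub argument: moving the mass of `a` to the largest and that of `b` to the smallest
entries of `lam` only increases the sum. If `2 j < m` the two ends are disjoint and are treated
separately; otherwise the optimal `a - b` is `1` on the first half and `-1` on the last. -/
theorem sum_mul_sub_le_prefixSum_spread {m j : ℕ} {lam : Fin m → ℝ} (hlam : Antitone lam)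
    {a b : Fin m → ℝ} (ha0 : ∀ i, 0 ≤ a i) (ha1 : ∀ i, a i ≤ 1) (hb0 : ∀ i, 0 ≤ b i)
    (hb1 : ∀ i, b i ≤ 1) (hab : ∑ i, a i = ∑ i, b i) (haj : ∑ i, a i ≤ j) :
    ∑ i, lam i * (a i - b i) ≤
      prefixSum j (fun i : Fin (m / 2) => lam (i.castLE (Nat.div_le_self _ 2)) -
        lam (i.castLE (Nat.div_le_self _ 2)).rev) := by
  rw [prefixSum_spread_eq]
  rcases Nat.eq_zero_or_pos m with rfl | hm
  · simp
  set q := min j (m / 2) with hq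
  have hqm : q ≤ m := by omega
  have e1 := sum_ite_lt hqm
  have e2 := sum_ite_ge hqm
  rcases lt_or_ge (2 * j) m with hj | hj
  · have hqj : q = j := by omega
    -- The thresholds are the first entry after the top `q` and the last entry before the bottom
    -- `q`. The missing mass `q - ∑ a` contributes `(α - β) (q - ∑ a) ≥ 0`.
    set α := lam ⟨q, by omega⟩
    set β := lam ⟨m - 1 - q, by omega⟩
    have hαβ : β ≤ α := hlam (by simp only [Fin.mk_le_mk]; omega)
    have h1 : 0 ≤ ∑ i : Fin m, (lam i - α) * ((if (i : ℕ) < q then 1 else 0) - a i) := by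
      refine Finset.sum_nonneg fun i _ => ?_
      split_ifs with hi
      · have : α ≤ lam i := hlam (by rw [Fin.le_def]; simp only; omega)
        exact mul_nonneg (by linarith) (by linarith [ha1 i])
      · have : lam i ≤ α := hlam (by rw [Fin.le_def]; simp only; omega)
        nlinarith [ha0 i]
    have h2 : 0 ≤ ∑ i : Fin m, (lam i - β) * (b i - (if m - q ≤ (i : ℕ) then 1 else 0)) := by
      refine Finset.sum_nonneg fun i _ => ?_
      split_ifs with hi
      · have : lam i ≤ β := hlam (by rw [Fin.le_def]; simp only; omega)
        nlinarith [hb1 i]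
      · have : β ≤ lam i := hlam (by rw [Fin.le_def]; simp only; omega)
        exact mul_nonneg (by linarith) (by linarith [hb0 i])
    simp only [sub_mul, mul_sub, Finset.sum_sub_distrib, ← Finset.mul_sum, e1, e2] at h1 h2 ⊢
    rw [hqj] at *
    rw [← hab] at h2
    nlinarith
  · have hq2 : q = m / 2 := by omega
    -- One threshold suffices here, since both differences of weights have total mass zero.
    set μ := lam ⟨m / 2, by omega⟩
    have h1 : 0 ≤ ∑ i : Fin m, (lam i - μ) * (((if (i : ℕ) < q then 1 else 0) -
        (if m - q ≤ (i : ℕ) then 1 else 0)) - (a i - b i)) := by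
      refine Finset.sum_nonneg fun i _ => ?_
      have := ha0 i; have := ha1 i; have := hb0 i; have := hb1 i
      split_ifs with hi hi' hi'
      · omega
      · have : μ ≤ lam i := hlam (by rw [Fin.le_def]; simp only; omega)
        exact mul_nonneg (by linarith) (by linarith)
      · have : lam i ≤ μ := hlam (by rw [Fin.le_def]; simp only; omega)
        nlinarith
      -- Only the middle index for odd `m` remains, where the optimal weight is `0`.
      · have : lam i = μ := by
          congr 1
          ext
          simp only
          omega
        simp [this]
    simp only [sub_mul, mul_sub, Finset.sum_sub_distrib, ← Finset.mul_sum, e1, e2] at h1 ⊢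
    rw [hab] at h1
    linarith

/-- Abel summation: weights that decrease to a non-negative value preserve an inequality between
partial sums. -/
theorem sum_mul_le_sum_mul_of_prefixSum_le {n : ℕ} {w β γ : Fin n → ℝ} (hw : Antitone w)
    (hw0 : ∀ i, 0 ≤ w i) (H : ∀ k ≤ n, prefixSum k β ≤ prefixSum k γ) :
    ∑ i, w i * β i ≤ ∑ i, w i * γ i := by
  -- The lower bound `c` makes the induction run: after peeling off the last entry, its weight plays
  -- the role of `c` for the others.
  have key : ∀ (n : ℕ) (w δ : Fin n → ℝ) (c : ℝ), Antitone w → 0 ≤ c → (∀ i, c ≤ w i) →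
      (∀ k ≤ n, 0 ≤ prefixSum k δ) → c * ∑ i, δ i ≤ ∑ i, w i * δ i := by
    intro n
    induction n with
    | zero => intros; simp
    | succ n ih =>
      intro w δ c hw hc hcw hδ
      have hlast := ih (fun i => w i.castSucc) (fun i => δ i.castSucc) (w (Fin.last n))
        (fun a b hab => hw (Fin.castSucc_le_castSucc_iff.mpr hab)) (hc.trans (hcw _))
        (fun i => hw (Fin.le_last _)) (fun k hk => by
          have := hδ k (by omega)
          rw [prefixSum, Fin.sum_univ_castSucc] at this
          simpa [prefixSum, not_lt.mpr hk] using this)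
      have hall : 0 ≤ ∑ i, δ i := by
        have := hδ (n + 1) le_rfl
        simpa [prefixSum, Fin.is_le] using this
      calc c * ∑ i, δ i ≤ w (Fin.last n) * ∑ i, δ i :=
            mul_le_mul_of_nonneg_right (hcw _) hall
        _ ≤ ∑ i, w i * δ i := by
            rw [Fin.sum_univ_castSucc, Fin.sum_univ_castSucc, mul_add]
            linarith
  have h := key n w (fun i => γ i - β i) 0 hw le_rfl hw0 (fun k hk => by
    have := H k hk
    have h2 : prefixSum k (fun i => γ i - β i) = prefixSum k γ - prefixSum k β := by
      simp only [prefixSum, ← Finset.sum_sub_distrib]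
      refine Finset.sum_congr rfl fun i _ => ?_
      split_ifs <;> simp
    rw [h2]
    linarith)
  simp only [mul_sub, Finset.sum_sub_distrib, zero_mul] at h
  linarith

/-! ### Families satisfying Bessel's inequality -/

section Bessel

variable {κ E F : Type*} [Fintype κ] [NormedAddCommGroup E] [InnerProductSpace ℂ E]
  [NormedAddCommGroup F] [InnerProductSpace ℂ F]

/-- A finite family of vectors satisfying Bessel's inequality. -/
def IsBessel (f : κ → E) : Prop :=
  ∀ x, ∑ i, ‖inner ℂ (f i) x‖ ^ 2 ≤ ‖x‖ ^ 2

theorem norm_sq_add_eq (x y : E) :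
    ‖x + y‖ ^ 2 = ‖x‖ ^ 2 + 2 * (inner ℂ x y).re + ‖y‖ ^ 2 :=
  norm_add_sq (𝕜 := ℂ) x y

theorem norm_sq_sub_eq (x y : E) :
    ‖x - y‖ ^ 2 = ‖x‖ ^ 2 - 2 * (inner ℂ x y).re + ‖y‖ ^ 2 :=
  norm_sub_sq (𝕜 := ℂ) x y

theorem re_inner_comm (x y : E) : (inner ℂ x y).re = (inner ℂ y x).re := by
  rw [← inner_conj_symm, Complex.conj_re]

theorem IsBessel.norm_le_one {f : κ → E} (hf : IsBessel f) (i : κ) : ‖f i‖ ≤ 1 := by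
  have h1 := hf (f i)
  have h2 : ‖inner ℂ (f i) (f i)‖ ^ 2 ≤ ∑ l, ‖inner ℂ (f l) (f i)‖ ^ 2 :=
    Finset.single_le_sum (f := fun l => ‖inner ℂ (f l) (f i)‖ ^ 2)
      (fun _ _ => by positivity) (Finset.mem_univ i)
  rw [inner_self_eq_norm_sq_to_K, norm_pow] at h2
  simp only [Complex.coe_algebraMap, Complex.norm_real, norm_norm] at h2
  by_contra! hc
  have h3 : (1 : ℝ) < ‖f i‖ ^ 2 := by nlinarith
  nlinarith

theorem IsBessel.comp_injective {κ' : Type*} [Fintype κ'] {f : κ → E} (hf : IsBessel f)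
    {e : κ' → κ} (he : Function.Injective e) : IsBessel (f ∘ e) := by
  classical
  intro x
  refine le_trans ?_ (hf x)
  simp only [Function.comp_apply]
  rw [← Finset.sum_image (s := Finset.univ) (g := e)
    (f := fun i => ‖inner ℂ (f i) x‖ ^ 2) (fun a _ b _ h => he h)]
  exact Finset.sum_le_sum_of_subset_of_nonneg (Finset.subset_univ _) fun _ _ _ => by positivity

theorem IsBessel.map {f : κ → E} (hf : IsBessel f) {V : E → F} {V' : F → E}
    (hV : ∀ x y, inner ℂ (V x) y = inner ℂ x (V' y)) (hV' : ∀ y, ‖V' y‖ ≤ ‖y‖) :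
    IsBessel fun i => V (f i) := by
  intro x
  simp only [hV]
  exact (hf _).trans (pow_le_pow_left₀ (norm_nonneg _) (hV' x) 2)

theorem IsBessel.const_smul {f : κ → E} (hf : IsBessel f) {c : ℂ} (hc : ‖c‖ ≤ 1) :
    IsBessel fun i => c • f i :=
  hf.map (V := fun x => c • x) (V' := fun x => (starRingEnd ℂ c) • x)
    (fun x y => by rw [inner_smul_left, inner_smul_right]) fun y => by
      rw [norm_smul, RCLike.norm_conj]
      exact mul_le_of_le_one_left (norm_nonneg _) hc

/-- Expanding `0 ≤ ‖x - S‖²` for `S = ∑ ⟨f_i, x⟩ f_i` proves it, because `‖S‖²` is at most the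
Bessel sum. Zero vectors are allowed, as needed for singular vectors of vanishing singular values.
-/
theorem isBessel_of_orthogonal {f : κ → E} (ho : ∀ a b, a ≠ b → inner ℂ (f a) (f b) = 0)
    (hf : ∀ i, ‖f i‖ ≤ 1) : IsBessel f := by
  classical
  intro x
  set S := ∑ i, inner ℂ (f i) x • f i
  have h1 : (inner ℂ x S).re = ∑ i, ‖inner ℂ (f i) x‖ ^ 2 := by
    simp only [S, inner_sum, inner_smul_right, Complex.re_sum]
    refine Finset.sum_congr rfl fun i _ => ?_
    rw [← inner_conj_symm x, Complex.mul_conj, Complex.ofReal_re, Complex.normSq_eq_norm_sq]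
  have h2 : ‖S‖ ^ 2 ≤ ∑ i, ‖inner ℂ (f i) x‖ ^ 2 := by
    have h3 : (inner ℂ S S).re = ∑ i, ‖inner ℂ (f i) x‖ ^ 2 * ‖f i‖ ^ 2 := by
      have : ∀ i, inner ℂ (f i) S = inner ℂ (f i) x * (‖f i‖ ^ 2 : ℝ) := by
        intro i
        simp only [S, inner_sum, inner_smul_right]
        rw [Finset.sum_eq_single i (fun b _ hb => by rw [ho i b hb.symm, mul_zero]) (by simp),
          inner_self_eq_norm_sq_to_K]
        simp
      nth_rewrite 1 [show S = ∑ i, inner ℂ (f i) x • f i from rfl]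
      simp only [sum_inner, inner_smul_left, this, Complex.re_sum]
      refine Finset.sum_congr rfl fun i _ => ?_
      rw [← mul_assoc, mul_comm ((starRingEnd ℂ) _), Complex.mul_conj, ← Complex.ofReal_mul,
        Complex.ofReal_re, Complex.normSq_eq_norm_sq]
    have h4 : ‖S‖ ^ 2 = (inner ℂ S S).re := by
      rw [inner_self_eq_norm_sq_to_K]
      norm_cast
    rw [h4, h3]
    refine Finset.sum_le_sum fun i _ => ?_
    have : ‖f i‖ ^ 2 ≤ 1 := pow_le_one₀ (norm_nonneg _) (hf i)
    exact mul_le_of_le_one_right (by positivity) this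
  have h3 := norm_sq_sub_eq x S
  have h4 : 0 ≤ ‖x - S‖ ^ 2 := by positivity
  linarith

theorem Orthonormal.isBessel {f : κ → E} (hf : Orthonormal ℂ f) : IsBessel f :=
  isBessel_of_orthogonal (fun _ _ hab => hf.2 hab) fun i => (hf.1 i).le

/-- The synthesis map is the adjoint of the analysis map, hence also a contraction. -/
theorem IsBessel.norm_sum_sq_le {f : κ → E} (hf : IsBessel f) (c : κ → ℂ) :
    ‖∑ i, c i • f i‖ ^ 2 ≤ ∑ i, ‖c i‖ ^ 2 := by
  set S := ∑ i, c i • f i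
  have h1 : ‖S‖ ^ 2 = ∑ i, (starRingEnd ℂ (c i) * inner ℂ (f i) S).re := by
    have h4 : ‖S‖ ^ 2 = (inner ℂ S S).re := by
      rw [inner_self_eq_norm_sq_to_K]
      norm_cast
    rw [h4]
    nth_rewrite 1 [show S = ∑ i, c i • f i from rfl]
    simp only [sum_inner, inner_smul_left, Complex.re_sum]
  have h2 : ∀ i, (starRingEnd ℂ (c i) * inner ℂ (f i) S).re ≤
      (‖c i‖ ^ 2 + ‖inner ℂ (f i) S‖ ^ 2) / 2 := by
    intro i
    refine (Complex.re_le_norm _).trans ?_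
    rw [norm_mul, RCLike.norm_conj]
    nlinarith [sq_nonneg (‖c i‖ - ‖inner ℂ (f i) S‖)]
  have h3 := Finset.sum_le_sum fun i (_ : i ∈ Finset.univ) => h2 i
  rw [← h1, ← Finset.sum_div, Finset.sum_add_distrib] at h3
  linarith [hf S]

end Bessel

/-! ### Variational bounds for eigenvalues and singular values -/

section Spectral

variable {E F : Type*} [NormedAddCommGroup E] [InnerProductSpace ℂ E] [FiniteDimensional ℂ E]
  [NormedAddCommGroup F] [InnerProductSpace ℂ F] [FiniteDimensional ℂ F]

theorem re_inner_apply_self_eq_sum {T : E →ₗ[ℂ] E} (hT : T.IsSymmetric) {m : ℕ}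
    (hm : Module.finrank ℂ E = m) (x : E) :
    (inner ℂ x (T x)).re =
      ∑ l, hT.eigenvalues hm l * ‖inner ℂ x (hT.eigenvectorBasis hm l)‖ ^ 2 := by
  rw [← (hT.eigenvectorBasis hm).sum_inner_mul_inner x (T x), Complex.re_sum]
  refine Finset.sum_congr rfl fun l _ => ?_
  rw [← hT, hT.apply_eigenvectorBasis, inner_smul_left, ← inner_conj_symm _ x]
  simp only [Complex.coe_algebraMap, Complex.conj_ofReal]
  rw [mul_left_comm, Complex.re_ofReal_mul, Complex.mul_conj, Complex.ofReal_re,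
    Complex.normSq_eq_norm_sq]

/-- A Ky Fan type inequality for differences of traces. -/
theorem sum_re_inner_sub_le {T : E →ₗ[ℂ] E} (hT : T.IsSymmetric) {m : ℕ}
    (hm : Module.finrank ℂ E = m) {j : ℕ} {f g : Fin j → E} (hf : IsBessel f) (hg : IsBessel g)
    (hfg : ∑ i, ‖f i‖ ^ 2 = ∑ i, ‖g i‖ ^ 2) :
    ∑ i, (inner ℂ (f i) (T (f i))).re - ∑ i, (inner ℂ (g i) (T (g i))).re ≤
      prefixSum j (fun i : Fin (m / 2) => hT.eigenvalues hm (i.castLE (Nat.div_le_self _ 2)) -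
        hT.eigenvalues hm (i.castLE (Nat.div_le_self _ 2)).rev) := by
  set b := hT.eigenvectorBasis hm with hb
  set lam := hT.eigenvalues hm with hlam
  have h1 : ∀ f : Fin j → E, ∑ i, (inner ℂ (f i) (T (f i))).re =
      ∑ l, lam l * ∑ i, ‖inner ℂ (f i) (b l)‖ ^ 2 := by
    intro f
    simp only [re_inner_apply_self_eq_sum hT hm, Finset.mul_sum]
    rw [Finset.sum_comm]
  have h2 : ∀ f : Fin j → E, ∑ l, ∑ i, ‖inner ℂ (f i) (b l)‖ ^ 2 = ∑ i, ‖f i‖ ^ 2 := by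
    intro f
    rw [Finset.sum_comm]
    refine Finset.sum_congr rfl fun i _ => ?_
    rw [← b.sum_sq_norm_inner_left (f i)]
  -- Bessel's inequality tested on eigenvectors says exactly that the weights are at most `1`.
  have h3 : ∀ f : Fin j → E, IsBessel f → ∀ l, ∑ i, ‖inner ℂ (f i) (b l)‖ ^ 2 ≤ 1 := by
    intro f hf l
    simpa [b.norm_eq_one] using hf (b l)
  rw [h1, h1, ← Finset.sum_sub_distrib]
  simp only [← mul_sub]
  refine sum_mul_sub_le_prefixSum_spread (hT.eigenvalues_antitone hm)
    (fun l => Finset.sum_nonneg fun _ _ => by positivity) (h3 f hf)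
    (fun l => Finset.sum_nonneg fun _ _ => by positivity) (h3 g hg) ?_ ?_
  · rw [h2, h2, hfg]
  · rw [h2]
    calc ∑ i, ‖f i‖ ^ 2 ≤ ∑ _i : Fin j, (1 : ℝ) :=
          Finset.sum_le_sum fun i _ => pow_le_one₀ (norm_nonneg _) (hf.norm_le_one i)
      _ = j := by simp

/-- The singular value decomposition. -/
theorem exists_singularValueDecomposition (M : E →ₗ[ℂ] F) {n : ℕ}
    (hn : Module.finrank ℂ E = n) :
    ∃ (v : OrthonormalBasis (Fin n) ℂ E) (u : Fin n → F), IsBessel u ∧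
      (∀ l, M (v l) = (M.singularValues l : ℂ) • u l) ∧
      (∀ l, inner ℂ (u l) (M (v l)) = (M.singularValues l : ℂ)) ∧
      ∀ (y : E) (b : Fin n), inner ℂ (M y) (M (v b)) =
        ((M.singularValues b ^ 2 : ℝ) : ℂ) * inner ℂ y (v b) := by
  classical
  set hT := M.isSymmetric_adjoint_comp_self
  set v := hT.eigenvectorBasis hn with hv
  have h4 : ∀ (y : E) (b : Fin n), inner ℂ (M y) (M (v b)) =
      ((M.singularValues b ^ 2 : ℝ) : ℂ) * inner ℂ y (v b) := by
    intro y b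
    have h2 : (LinearMap.adjoint M) (M (v b)) = (hT.eigenvalues hn b : ℂ) • v b :=
      hT.apply_eigenvectorBasis hn b
    rw [← LinearMap.adjoint_inner_right, h2, inner_smul_right, M.sq_singularValues_fin hn b]
  have h1 : ∀ a b : Fin n, inner ℂ (M (v a)) (M (v b)) =
      if a = b then ((M.singularValues a ^ 2 : ℝ) : ℂ) else 0 := by
    intro a b
    rw [h4, orthonormal_iff_ite.mp v.orthonormal a b]
    split_ifs with h
    · rw [h, mul_one]
    · rw [mul_zero]
  have h0 : ∀ a : Fin n, M.singularValues a = 0 → M (v a) = 0 := by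
    intro a ha
    have := h1 a a
    rw [if_pos rfl, ha] at this
    simpa using this
  -- For a vanishing singular value `0⁻¹ = 0` makes the left vector zero, so `u` is a Bessel family
  -- but not always orthonormal.
  refine ⟨v, fun l => ((M.singularValues l : ℂ)⁻¹) • M (v l), ?_, ?_, ?_, h4⟩
  · refine isBessel_of_orthogonal (fun a b hab => ?_) fun i => ?_
    · rw [inner_smul_left, inner_smul_right, h1, if_neg hab]
      simp
    · by_cases hi : M.singularValues i = 0
      · rw [h0 i hi]; simp
      · have h2 : ‖M (v i)‖ ^ 2 = M.singularValues i ^ 2 := by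
          have h3 := h1 i i
          rw [if_pos rfl, inner_self_eq_norm_sq_to_K] at h3
          exact Complex.ofReal_injective (by simpa using h3)
        have h3 : ‖M (v i)‖ = M.singularValues i := by
          rwa [sq_eq_sq₀ (norm_nonneg _) (M.singularValues_nonneg i)] at h2
        rw [norm_smul, h3, norm_inv, Complex.norm_real, Real.norm_of_nonneg
          (M.singularValues_nonneg i), inv_mul_cancel₀ hi]
  · intro l
    by_cases hl : M.singularValues l = 0
    · simp [h0 l hl]
    · rw [smul_smul, mul_inv_cancel₀ (by exact_mod_cast hl), one_smul]
  · intro l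
    rw [inner_smul_left, h1, if_pos rfl]
    simp only [map_inv₀, Complex.conj_ofReal]
    by_cases hl : M.singularValues l = 0
    · simp [hl]
    · push_cast
      field_simp

/-- Sums of singular values are bounded by any bound for bilinear sums over Bessel families. -/
theorem sum_singularValues_le_of_isBessel (M : E →ₗ[ℂ] F) {n : ℕ}
    (hn : Module.finrank ℂ E = n) (s : Finset (Fin n)) {c : ℝ}
    (H : ∀ (u : Fin s.card → F) (v : Fin s.card → E), IsBessel u → IsBessel v →
      ∑ i, (inner ℂ (u i) (M (v i))).re ≤ c) :
    ∑ i ∈ s, M.singularValues i ≤ c := by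
  obtain ⟨v, u, hu, -, huv, -⟩ := exists_singularValueDecomposition M hn
  have he : Function.Injective (s.orderEmbOfFin rfl) := (s.orderEmbOfFin rfl).injective
  have h1 := H (u ∘ s.orderEmbOfFin rfl) (v ∘ s.orderEmbOfFin rfl) (hu.comp_injective he)
    (Orthonormal.isBessel (v.orthonormal.comp _ he))
  refine le_trans (le_of_eq ?_) h1
  simp only [Function.comp_apply, huv, Complex.ofReal_re]
  rw [← Finset.sum_image (s := Finset.univ) (g := s.orderEmbOfFin rfl)
    (f := fun i : Fin n => M.singularValues i) (fun a _ b _ h => he h),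
    Finset.image_orderEmbOfFin_univ]

end Spectral

/-! ### Block vectors and contractive commutators -/

section Pair

variable {ι κ : Type*}

/-- The vector of `ℂ^ι ⊕ ℂ^κ` with the given components. -/
def pair (a : EuclideanSpace ℂ ι) (b : EuclideanSpace ℂ κ) : EuclideanSpace ℂ (ι ⊕ κ) :=
  WithLp.toLp 2 (Sum.elim a b)

theorem exists_eq_pair (x : EuclideanSpace ℂ (ι ⊕ κ)) : ∃ a b, x = pair a b :=
  ⟨WithLp.toLp 2 fun i => x (Sum.inl i), WithLp.toLp 2 fun i => x (Sum.inr i), by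
    ext i
    rcases i with i | i <;> simp [pair]⟩

variable [Fintype ι] [Fintype κ]

theorem inner_pair (a c : EuclideanSpace ℂ ι) (b d : EuclideanSpace ℂ κ) :
    inner ℂ (pair a b) (pair c d) = inner ℂ a c + inner ℂ b d := by
  simp [pair, PiLp.inner_apply]

theorem norm_sq_pair (a : EuclideanSpace ℂ ι) (b : EuclideanSpace ℂ κ) :
    ‖pair a b‖ ^ 2 = ‖a‖ ^ 2 + ‖b‖ ^ 2 := by
  simp [pair, EuclideanSpace.norm_sq_eq]

theorem singVals_nonneg [DecidableEq κ] (B : Matrix ι κ ℂ) (i) : 0 ≤ singVals B i :=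
  LinearMap.singularValues_nonneg _ _

theorem antitone_singVals [DecidableEq κ] (B : Matrix ι κ ℂ) : Antitone (singVals B) :=
  fun _ _ hab => LinearMap.singularValues_antitone _ hab

end Pair

section Matrix

variable {ι κ : Type*} [Fintype ι] [DecidableEq ι] [Fintype κ] [DecidableEq κ]

/-- Ky Fan's inequality in terms of the spectral spread of a Hermitian matrix. -/
theorem sum_re_inner_sub_le_prefixSum_sprPos {A : Matrix ι ι ℂ} (hA : A.IsHermitian) {j : ℕ}
    {f g : Fin j → EuclideanSpace ℂ ι} (hf : IsBessel f) (hg : IsBessel g)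
    (hfg : ∑ i, ‖f i‖ ^ 2 = ∑ i, ‖g i‖ ^ 2) :
    ∑ i, (inner ℂ (f i) (Matrix.toEuclideanLin A (f i))).re -
      ∑ i, (inner ℂ (g i) (Matrix.toEuclideanLin A (g i))).re ≤ prefixSum j (sprPos hA) :=
  sum_re_inner_sub_le (Matrix.isSymmetric_toEuclideanLin_iff.mpr hA) finrank_euclideanSpace hf hg
    hfg

theorem antitone_sprPos {A : Matrix ι ι ℂ} (hA : A.IsHermitian) : Antitone (sprPos hA) := by
  intro a b hab
  have h1 := hA.eigenvalues₀_antitone (a := a.castLE (Nat.div_le_self _ 2))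
    (b := b.castLE (Nat.div_le_self _ 2)) hab
  have h2 := hA.eigenvalues₀_antitone (a := (b.castLE (Nat.div_le_self _ 2)).rev)
    (b := (a.castLE (Nat.div_le_self _ 2)).rev) (Fin.rev_le_rev.mpr hab)
  simp only [sprPos, spr]
  linarith

theorem sprPos_nonneg {A : Matrix ι ι ℂ} (hA : A.IsHermitian) (i) : 0 ≤ sprPos hA i := by
  have h1 := hA.eigenvalues₀_antitone (a := i.castLE (Nat.div_le_self _ 2))
    (b := (i.castLE (Nat.div_le_self _ 2)).rev) (by
      rw [Fin.le_def, Fin.val_rev, Fin.val_castLE]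
      have := i.2
      omega)
  simp only [sprPos, spr]
  linarith

theorem toEuclideanLin_fromBlocks_pair (A : Matrix ι ι ℂ) (B : Matrix ι κ ℂ) (C : Matrix κ ι ℂ)
    (D : Matrix κ κ ℂ) (a : EuclideanSpace ℂ ι) (b : EuclideanSpace ℂ κ) :
    Matrix.toEuclideanLin (Matrix.fromBlocks A B C D) (pair a b) =
      pair (Matrix.toEuclideanLin A a + Matrix.toEuclideanLin B b)
        (Matrix.toEuclideanLin C a + Matrix.toEuclideanLin D b) := by
  ext i
  rcases i with i | i <;> simp [pair, Matrix.toLpLin_apply, Matrix.fromBlocks_mulVec]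

theorem toEuclideanLin_mul_apply (A B : Matrix ι ι ℂ) (x : EuclideanSpace ℂ ι) :
    Matrix.toEuclideanLin (A * B) x = Matrix.toEuclideanLin A (Matrix.toEuclideanLin B x) := by
  simp [Matrix.toLpLin_apply]

theorem inner_toEuclideanLin_left (B : Matrix ι κ ℂ) (x : EuclideanSpace ℂ κ)
    (y : EuclideanSpace ℂ ι) :
    inner ℂ (Matrix.toEuclideanLin B x) y = inner ℂ x (Matrix.toEuclideanLin Bᴴ y) := by
  rw [Matrix.toEuclideanLin_conjTranspose_eq_adjoint, LinearMap.adjoint_inner_right]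

theorem IsHermitian.inner_toEuclideanLin {A : Matrix ι ι ℂ} (hA : A.IsHermitian)
    (x y : EuclideanSpace ℂ ι) :
    inner ℂ (Matrix.toEuclideanLin A x) y = inner ℂ x (Matrix.toEuclideanLin A y) :=
  Matrix.isSymmetric_toEuclideanLin_iff.mpr hA x y

/-- The generalized commutator of a contraction is controlled by the spectral spread. -/
theorem sum_re_inner_commutator_le_of_contraction {A₁ A₂ : Matrix ι ι ℂ} (h₁ : A₁.IsHermitian)
    (h₂ : A₂.IsHermitian) {X X' : EuclideanSpace ℂ ι → EuclideanSpace ℂ ι}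
    (hX : ∀ v, ‖X v‖ ≤ ‖v‖) (hX' : ∀ v, ‖X' v‖ ≤ ‖v‖)
    (hXX' : ∀ v w, inner ℂ (X v) w = inner ℂ v (X' w)) {j : ℕ}
    {u v : Fin j → EuclideanSpace ℂ ι} (hu : IsBessel u) (hv : IsBessel v) :
    ∑ i, ((inner ℂ (u i) (Matrix.toEuclideanLin A₁ (X (v i)))).re -
      (inner ℂ (X' (u i)) (Matrix.toEuclideanLin A₂ (v i))).re) ≤
      prefixSum j (sprPos (directSum_isHermitian h₁ h₂)) := by
  have hX'X : ∀ v w, inner ℂ (X' v) w = inner ℂ v (X w) := fun v w => by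
    rw [← inner_conj_symm, ← hXX', inner_conj_symm]
  -- By polarization the quadratic forms of `A₁ ⊕ A₂` on `f` and `g` differ by the wanted term. The
  -- opposite sign in the second component produces the minus sign of the commutator, and it makes
  -- the cross terms in the Bessel estimates cancel.
  set f : Fin j → EuclideanSpace ℂ (ι ⊕ ι) :=
    fun i => (1 / 2 : ℂ) • pair (u i + X (v i)) (v i - X' (u i)) with hf
  set g : Fin j → EuclideanSpace ℂ (ι ⊕ ι) :=
    fun i => (1 / 2 : ℂ) • pair (u i - X (v i)) (v i + X' (u i)) with hg
  have bound : ∀ p q : ℂ, ‖(1 / 2 : ℂ) * (p + q)‖ ^ 2 ≤ (‖p‖ ^ 2 + ‖q‖ ^ 2) / 2 := by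
    intro p q
    have h1 := norm_add_le p q
    rw [norm_mul, mul_pow]
    have h2 : ‖(1 / 2 : ℂ)‖ = 1 / 2 := by simp
    rw [h2]
    have h3 : ‖p + q‖ ^ 2 ≤ (‖p‖ + ‖q‖) ^ 2 := pow_le_pow_left₀ (norm_nonneg _) h1 2
    nlinarith [sq_nonneg (‖p‖ - ‖q‖)]
  have hconj : (starRingEnd ℂ) (1 / 2 : ℂ) = 1 / 2 := by
    rw [map_div₀, map_one, map_ofNat]
  have hsq : ∀ v, ‖X v‖ ^ 2 ≤ ‖v‖ ^ 2 := fun v => pow_le_pow_left₀ (norm_nonneg _) (hX v) 2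
  have hsq' : ∀ v, ‖X' v‖ ^ 2 ≤ ‖v‖ ^ 2 := fun v => pow_le_pow_left₀ (norm_nonneg _) (hX' v) 2
  have bf : IsBessel f := by
    intro x
    obtain ⟨a, b, rfl⟩ := exists_eq_pair x
    have h1 : ∀ i, inner ℂ (f i) (pair a b) =
        (1 / 2 : ℂ) * (inner ℂ (u i) (a - X b) + inner ℂ (v i) (X' a + b)) := by
      intro i
      simp only [hf, inner_smul_left, inner_pair, hconj, inner_add_left, inner_sub_left, hXX',
        hX'X, inner_add_right, inner_sub_right]
      ring
    calc ∑ i, ‖inner ℂ (f i) (pair a b)‖ ^ 2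
        ≤ ∑ i, (‖inner ℂ (u i) (a - X b)‖ ^ 2 + ‖inner ℂ (v i) (X' a + b)‖ ^ 2) / 2 :=
          Finset.sum_le_sum fun i _ => by rw [h1]; exact bound _ _
      _ ≤ (‖a - X b‖ ^ 2 + ‖X' a + b‖ ^ 2) / 2 := by
          rw [← Finset.sum_div, Finset.sum_add_distrib]
          linarith [hu (a - X b), hv (X' a + b)]
      _ ≤ ‖pair a b‖ ^ 2 := by
          rw [norm_sq_sub_eq, norm_sq_add_eq, norm_sq_pair, hX'X]
          linarith [hsq b, hsq' a]
  have bg : IsBessel g := by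
    intro x
    obtain ⟨a, b, rfl⟩ := exists_eq_pair x
    have h1 : ∀ i, inner ℂ (g i) (pair a b) =
        (1 / 2 : ℂ) * (inner ℂ (u i) (a + X b) + inner ℂ (v i) (b - X' a)) := by
      intro i
      simp only [hg, inner_smul_left, inner_pair, hconj, inner_add_left, inner_sub_left, hXX',
        hX'X, inner_add_right, inner_sub_right]
      ring
    calc ∑ i, ‖inner ℂ (g i) (pair a b)‖ ^ 2
        ≤ ∑ i, (‖inner ℂ (u i) (a + X b)‖ ^ 2 + ‖inner ℂ (v i) (b - X' a)‖ ^ 2) / 2 :=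
          Finset.sum_le_sum fun i _ => by rw [h1]; exact bound _ _
      _ ≤ (‖a + X b‖ ^ 2 + ‖b - X' a‖ ^ 2) / 2 := by
          rw [← Finset.sum_div, Finset.sum_add_distrib]
          linarith [hu (a + X b), hv (b - X' a)]
      _ ≤ ‖pair a b‖ ^ 2 := by
          rw [norm_sq_sub_eq, norm_sq_add_eq, norm_sq_pair, re_inner_comm b, hX'X]
          linarith [hsq b, hsq' a]
  have hfg : ∀ i, ‖f i‖ ^ 2 = ‖g i‖ ^ 2 := by
    intro i
    simp only [hf, hg, norm_smul, mul_pow, norm_sq_pair, norm_sq_sub_eq, norm_sq_add_eq]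
    rw [re_inner_comm (v i), hX'X]
    ring
  have key := sum_re_inner_sub_le_prefixSum_sprPos (directSum_isHermitian h₁ h₂) bf bg
    (Finset.sum_congr rfl fun i _ => hfg i)
  rw [← Finset.sum_sub_distrib] at key
  refine le_trans (le_of_eq (Finset.sum_congr rfl fun i _ => ?_)) key
  have hre : ∀ z : ℂ, ((1 / 2 : ℂ) * ((1 / 2 : ℂ) * z)).re = z.re / 4 := by
    intro z
    rw [show (1 / 2 : ℂ) * ((1 / 2 : ℂ) * z) = ((1 / 4 : ℝ) : ℂ) * z by push_cast; ring,
      Complex.re_ofReal_mul]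
    ring
  have e1 : (inner ℂ (X (v i)) (Matrix.toEuclideanLin A₁ (u i))).re =
      (inner ℂ (u i) (Matrix.toEuclideanLin A₁ (X (v i)))).re := by
    rw [← IsHermitian.inner_toEuclideanLin h₁, re_inner_comm]
  have e2 : (inner ℂ (v i) (Matrix.toEuclideanLin A₂ (X' (u i)))).re =
      (inner ℂ (X' (u i)) (Matrix.toEuclideanLin A₂ (v i))).re := by
    rw [← IsHermitian.inner_toEuclideanLin h₂, re_inner_comm]
  simp only [hf, hg, map_smul, inner_smul_left, inner_smul_right, hconj, directSum,
    toEuclideanLin_fromBlocks_pair, inner_pair, hre, map_zero, LinearMap.zero_apply, add_zero,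
    zero_add, map_add, map_sub, inner_add_left, inner_add_right, inner_sub_left, inner_sub_right,
    Complex.add_re, Complex.sub_re, e1, e2]
  ring

end Matrix

/-! ### Generalized commutators, differences and off-diagonal blocks -/

theorem antitone_entrywiseMul {k r : ℕ} {x : Fin k → ℝ} {y : Fin r → ℝ} (hx : Antitone x)
    (hy : Antitone y) (hx0 : ∀ i, 0 ≤ x i) (hy0 : ∀ i, 0 ≤ y i) :
    Antitone (entrywiseMul x y) := fun _ _ hab =>
  mul_le_mul (hx hab) (hy hab) (hy0 _) (hx0 _)

/-- Abel summation against `y` truncated after `j` entries, whose partial sums are `prefixSum (min j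
k) y`. -/
theorem sum_mul_le_prefixSum_entrywiseMul {n r j : ℕ} (hr : r = n) {w β : Fin n → ℝ}
    {y : Fin r → ℝ} (hw : Antitone w) (hw0 : ∀ i, 0 ≤ w i)
    (H : ∀ k ≤ n, prefixSum k β ≤ prefixSum (min j k) y) :
    ∑ i, w i * β i ≤ prefixSum j (entrywiseMul w y) := by
  subst hr
  refine (sum_mul_le_sum_mul_of_prefixSum_le (γ := fun i => if (i : ℕ) < j then y i else 0) hw hw0
    fun k hk => (H k hk).trans (le_of_eq ?_)).trans (le_of_eq ?_)
  · refine Finset.sum_congr rfl fun i _ => ?_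
    simp only [lt_min_iff]
    split_ifs <;> first | rfl | omega
  · rw [sum_fin_castLE (min_le_left r r) _ fun i hi => absurd i.2 (by rw [min_self] at hi; omega)]
    refine Finset.sum_congr rfl fun i _ => ?_
    simp only [Fin.val_castLE, entrywiseMul, mul_ite, mul_zero]

section RankOne

variable {κ E : Type*} [Fintype κ] [NormedAddCommGroup E] [InnerProductSpace ℂ E]

/-- Analysis with `y` followed by synthesis with `x`, both contractions. Applied to truncations of a
singular value decomposition with unit weights. -/
theorem norm_sum_inner_smul_le {x y : κ → E} (hx : IsBessel x) (hy : IsBessel y) (v : E) :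
    ‖∑ l, inner ℂ (y l) v • x l‖ ≤ ‖v‖ := by
  have h1 := (hx.norm_sum_sq_le fun l => inner ℂ (y l) v).trans (hy v)
  exact le_of_sq_le_sq h1 (norm_nonneg _)

theorem inner_sum_inner_smul (x y : κ → E) (v w : E) :
    inner ℂ (∑ l, inner ℂ (y l) v • x l) w = inner ℂ v (∑ l, inner ℂ (x l) w • y l) := by
  simp only [sum_inner, inner_sum, inner_smul_left, inner_smul_right, inner_conj_symm]
  exact Finset.sum_congr rfl fun l _ => mul_comm _ _

end RankOne

section Commutator

variable {ι : Type*} [Fintype ι] [DecidableEq ι]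

theorem sum_sum_re_commutator_le {A₁ A₂ : Matrix ι ι ℂ} (h₁ : A₁.IsHermitian)
    (h₂ : A₂.IsHermitian) {j k : ℕ} {u v : Fin j → EuclideanSpace ℂ ι}
    {x y : Fin k → EuclideanSpace ℂ ι} (hu : IsBessel u) (hv : IsBessel v) (hx : IsBessel x)
    (hy : IsBessel y) :
    ∑ i, ∑ l, (inner ℂ (u i) (Matrix.toEuclideanLin A₁ (x l)) * inner ℂ (y l) (v i) -
      inner ℂ (u i) (x l) * inner ℂ (y l) (Matrix.toEuclideanLin A₂ (v i))).re ≤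
      prefixSum j (sprPos (directSum_isHermitian h₁ h₂)) := by
  refine le_trans (le_of_eq (Finset.sum_congr rfl fun i _ => ?_))
    (sum_re_inner_commutator_le_of_contraction h₁ h₂ (norm_sum_inner_smul_le hx hy)
      (norm_sum_inner_smul_le hy hx) (inner_sum_inner_smul x y) hu hv)
  simp only [map_sum, map_smul, inner_sum, sum_inner, inner_smul_left, inner_smul_right,
    Complex.re_sum, Complex.sub_re, Finset.sum_sub_distrib, inner_conj_symm]
  congr 1
  exact Finset.sum_congr rfl fun l _ => by rw [mul_comm]

/-- The double sum is symmetric, up to conjugation, under exchanging `(u, v)` with `(x, y)`. The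
previous bound can therefore be indexed by the number `k` of singular vectors instead of `j`. -/
theorem sum_sum_re_commutator_le' {A₁ A₂ : Matrix ι ι ℂ} (h₁ : A₁.IsHermitian)
    (h₂ : A₂.IsHermitian) {j k : ℕ} {u v : Fin j → EuclideanSpace ℂ ι}
    {x y : Fin k → EuclideanSpace ℂ ι} (hu : IsBessel u) (hv : IsBessel v) (hx : IsBessel x)
    (hy : IsBessel y) :
    ∑ i, ∑ l, (inner ℂ (u i) (Matrix.toEuclideanLin A₁ (x l)) * inner ℂ (y l) (v i) -
      inner ℂ (u i) (x l) * inner ℂ (y l) (Matrix.toEuclideanLin A₂ (v i))).re ≤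
      prefixSum k (sprPos (directSum_isHermitian h₁ h₂)) := by
  rw [Finset.sum_comm]
  refine le_trans (le_of_eq (Finset.sum_congr rfl fun l _ => Finset.sum_congr rfl fun i _ => ?_))
    (sum_sum_re_commutator_le h₁ h₂ hx hy hu hv)
  rw [← Complex.conj_re]
  simp only [map_sub, map_mul, inner_conj_symm]
  rw [IsHermitian.inner_toEuclideanLin h₁, IsHermitian.inner_toEuclideanLin h₂]

theorem sum_re_inner_commutator_le {A₁ A₂ : Matrix ι ι ℂ} (h₁ : A₁.IsHermitian)
    (h₂ : A₂.IsHermitian) (X : Matrix ι ι ℂ) {j : ℕ} {u v : Fin j → EuclideanSpace ℂ ι}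
    (hu : IsBessel u) (hv : IsBessel v) :
    ∑ i, (inner ℂ (u i) (Matrix.toEuclideanLin (A₁ * X - X * A₂) (v i))).re ≤
      prefixSum j (entrywiseMul (singVals X) (sprPos (directSum_isHermitian h₁ h₂))) := by
  obtain ⟨y, x, hx, hyx, -, -⟩ := exists_singularValueDecomposition (Matrix.toEuclideanLin X)
    (finrank_euclideanSpace (𝕜 := ℂ) (ι := ι))
  have hXv : ∀ v, Matrix.toEuclideanLin X v =
      ∑ l, ((singVals X l : ℂ) * inner ℂ (y l) v) • x l := by
    intro v
    conv_lhs => rw [← y.sum_repr' v]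
    simp only [map_sum, map_smul, hyx, smul_smul]
    exact Finset.sum_congr rfl fun l _ => by rw [mul_comm]; rfl
  -- The contribution of the `l`-th rank one term of `X`, with its singular value taken out.
  set β : Fin (Fintype.card ι) → ℝ := fun l => ∑ i,
    (inner ℂ (u i) (Matrix.toEuclideanLin A₁ (x l)) * inner ℂ (y l) (v i) -
      inner ℂ (u i) (x l) * inner ℂ (y l) (Matrix.toEuclideanLin A₂ (v i))).re with hβ
  have h1 : ∑ i, (inner ℂ (u i) (Matrix.toEuclideanLin (A₁ * X - X * A₂) (v i))).re =
      ∑ l, singVals X l * β l := by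
    simp only [hβ, Finset.mul_sum]
    rw [Finset.sum_comm]
    refine Finset.sum_congr rfl fun i _ => ?_
    rw [map_sub, LinearMap.sub_apply, toEuclideanLin_mul_apply, toEuclideanLin_mul_apply, hXv, hXv,
      inner_sub_right]
    simp only [map_sum, map_smul, inner_sum, inner_smul_right]
    rw [← Finset.sum_sub_distrib, Complex.re_sum]
    refine Finset.sum_congr rfl fun l _ => ?_
    rw [← Complex.re_ofReal_mul]
    congr 1
    ring
  rw [h1]
  refine sum_mul_le_prefixSum_entrywiseMul (by rw [Fintype.card_sum]; omega) (antitone_singVals X)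
    (singVals_nonneg X) fun k hk => ?_
  have h2 : prefixSum k β = ∑ i, ∑ l : Fin k,
      (inner ℂ (u i) (Matrix.toEuclideanLin A₁ (x (l.castLE hk))) *
          inner ℂ (y (l.castLE hk)) (v i) -
        inner ℂ (u i) (x (l.castLE hk)) *
          inner ℂ (y (l.castLE hk)) (Matrix.toEuclideanLin A₂ (v i))).re := by
    rw [Finset.sum_comm, prefixSum, sum_fin_castLE hk _ fun i hi => if_neg (not_lt.mpr hi)]
    simp only [Fin.val_castLE, Fin.is_lt, if_true, hβ]
  have hx' : IsBessel (x ∘ Fin.castLE hk) := hx.comp_injective (Fin.castLE_injective hk)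
  have hy' : IsBessel (y ∘ Fin.castLE hk) :=
    (Orthonormal.isBessel y.orthonormal).comp_injective (Fin.castLE_injective hk)
  rw [h2]
  -- Abel summation needs the bound at `min j k`, which is supplied by one of the two symmetric
  -- forms.
  rcases le_total j k with h | h
  · rw [min_eq_left h]
    exact sum_sum_re_commutator_le h₁ h₂ hu hv hx' hy'
  · rw [min_eq_right h]
    exact sum_sum_re_commutator_le' h₁ h₂ hu hv hx' hy'

theorem submajorized_commutator {A₁ A₂ : Matrix ι ι ℂ} (h₁ : A₁.IsHermitian)
    (h₂ : A₂.IsHermitian) (X : Matrix ι ι ℂ) :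
    Submajorized (singVals (A₁ * X - X * A₂))
      (entrywiseMul (singVals X) (sprPos (directSum_isHermitian h₁ h₂))) :=
  submajorized_of_finset
    (antitone_entrywiseMul (antitone_singVals X) (antitone_sprPos _) (singVals_nonneg X)
      (sprPos_nonneg _))
    (fun _ => mul_nonneg (singVals_nonneg X _) (sprPos_nonneg _ _)) fun s =>
    sum_singularValues_le_of_isBessel _ finrank_euclideanSpace s fun _ _ hu hv =>
      sum_re_inner_commutator_le h₁ h₂ X hu hv

theorem submajorized_sub {A₁ A₂ : Matrix ι ι ℂ} (h₁ : A₁.IsHermitian) (h₂ : A₂.IsHermitian) :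
    Submajorized (singVals (A₁ - A₂)) (sprPos (directSum_isHermitian h₁ h₂)) :=
  submajorized_of_finset (antitone_sprPos _) (sprPos_nonneg _) fun s =>
    sum_singularValues_le_of_isBessel _ finrank_euclideanSpace s fun u v hu hv => by
      refine le_trans (le_of_eq (Finset.sum_congr rfl fun i _ => ?_))
        (sum_re_inner_commutator_le_of_contraction h₁ h₂ (X := id) (X' := id) (fun _ => le_rfl)
          (fun _ => le_rfl) (fun _ _ => rfl) hu hv)
      simp

theorem submajorized_offDiagonal {A₁ A₂ B : Matrix ι ι ℂ}
    (hA : (Matrix.fromBlocks A₁ B Bᴴ A₂).IsHermitian) :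
    Submajorized ((2 : ℝ) • singVals B) (sprPos hA) := by
  refine submajorized_of_finset (antitone_sprPos _) (sprPos_nonneg _) fun s => ?_
  simp only [Pi.smul_apply, smul_eq_mul, ← Finset.mul_sum]
  suffices ∑ i ∈ s, singVals B i ≤ prefixSum s.card (sprPos hA) / 2 by linarith
  refine sum_singularValues_le_of_isBessel (Matrix.toEuclideanLin B) finrank_euclideanSpace s
    fun u v hu hv => ?_
  -- The factor `1/√2` makes the pairs `(u, ±v)` Bessel again. The two quadratic forms then differ
  -- by exactly `2 Re ⟨u, B v⟩`.
  set r : ℂ := (((√2 : ℝ)⁻¹ : ℝ) : ℂ) with hr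
  have hrr : ∀ z : ℂ, (r * (r * z)).re = z.re / 2 := by
    intro z
    rw [← mul_assoc, hr, ← Complex.ofReal_mul, Complex.re_ofReal_mul, ← mul_inv,
      Real.mul_self_sqrt (by norm_num)]
    ring
  have hrc : (starRingEnd ℂ) r = r := Complex.conj_ofReal _
  have bound : ∀ p q : ℂ, ‖r * (p + q)‖ ^ 2 ≤ ‖p‖ ^ 2 + ‖q‖ ^ 2 := by
    intro p q
    have h1 := norm_add_le p q
    have h2 : ‖r‖ ^ 2 = 1 / 2 := by
      rw [hr, Complex.norm_real, Real.norm_eq_abs, sq_abs, inv_pow, Real.sq_sqrt (by norm_num)]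
      norm_num
    rw [norm_mul, mul_pow, h2]
    have h3 : ‖p + q‖ ^ 2 ≤ (‖p‖ + ‖q‖) ^ 2 := pow_le_pow_left₀ (norm_nonneg _) h1 2
    nlinarith [sq_nonneg (‖p‖ - ‖q‖)]
  have bessel : ∀ w : Fin s.card → EuclideanSpace ℂ ι, IsBessel w →
      IsBessel fun i => r • pair (u i) (w i) := by
    intro w hw x
    obtain ⟨a, b, rfl⟩ := exists_eq_pair x
    rw [norm_sq_pair]
    refine le_trans ?_ (add_le_add (hu a) (hw b))
    rw [← Finset.sum_add_distrib]
    refine Finset.sum_le_sum fun i _ => ?_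
    rw [inner_smul_left, inner_pair, hrc]
    exact bound _ _
  have key := sum_re_inner_sub_le_prefixSum_sprPos hA (bessel v hv)
    (bessel (fun i => -v i) (hv.map (V := fun x => -x) (V' := fun x => -x) (by simp) (by simp)))
    (Finset.sum_congr rfl fun i _ => by simp only [norm_smul, mul_pow, norm_sq_pair, norm_neg])
  rw [← Finset.sum_sub_distrib] at key
  have h1 : ∀ i, (inner ℂ (v i) (Matrix.toEuclideanLin Bᴴ (u i))).re =
      (inner ℂ (u i) (Matrix.toEuclideanLin B (v i))).re := by
    intro i
    rw [← inner_toEuclideanLin_left, re_inner_comm]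
  have h2 : ∑ i, 2 * (inner ℂ (u i) (Matrix.toEuclideanLin B (v i))).re ≤
      prefixSum s.card (sprPos hA) := by
    refine le_trans (le_of_eq (Finset.sum_congr rfl fun i _ => ?_)) key
    simp only [map_smul, inner_smul_left, inner_smul_right, hrc, hrr,
      toEuclideanLin_fromBlocks_pair, inner_pair, map_neg, inner_add_right, inner_neg_left,
      inner_neg_right, Complex.add_re, Complex.neg_re, h1]
    ring
  rw [← Finset.mul_sum] at h2
  linarith

end Commutator

/-! ### One-parameter unitary groups and their expansions -/

section Flow

variable {κ E : Type*} [Fintype κ] [NormedAddCommGroup E] [InnerProductSpace ℂ E]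

/-- The one-parameter unitary group with eigenbasis `b` and generators `lam`. -/
def flow (b : OrthonormalBasis κ ℂ E) (lam : κ → ℝ) (t : ℝ) : E →ₗ[ℂ] E :=
  ∑ l, Complex.exp (((t * lam l : ℝ) : ℂ) * Complex.I) •
    ((innerSL ℂ (b l)).toLinearMap).smulRight (b l)

variable (b : OrthonormalBasis κ ℂ E) (lam : κ → ℝ)

theorem inner_flow (t : ℝ) (l : κ) (x : E) :
    inner ℂ (b l) (flow b lam t x) =
      Complex.exp (((t * lam l : ℝ) : ℂ) * Complex.I) * inner ℂ (b l) x := by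
  classical
  simp only [flow, LinearMap.sum_apply, LinearMap.smul_apply, LinearMap.smulRight_apply, inner_sum,
    inner_smul_right]
  rw [Finset.sum_eq_single l]
  · simp [b.norm_eq_one]
  · intro a _ ha
    rw [b.inner_eq_zero ha.symm, mul_zero, mul_zero]
  · simp

theorem ext_inner_basis {x y : E} (h : ∀ l, inner ℂ (b l) x = inner ℂ (b l) y) : x = y := by
  rw [← b.sum_repr' x, ← b.sum_repr' y]
  simp only [h]

theorem flow_zero (x : E) : flow b lam 0 x = x :=
  ext_inner_basis b fun l => by simp [inner_flow]

theorem flow_add (s t : ℝ) (x : E) : flow b lam (s + t) x = flow b lam s (flow b lam t x) :=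
  ext_inner_basis b fun l => by
    rw [inner_flow, inner_flow, inner_flow, ← mul_assoc, ← Complex.exp_add]
    congr 2
    push_cast
    ring

theorem inner_flow_left (t : ℝ) (x y : E) :
    inner ℂ (flow b lam t x) y = inner ℂ x (flow b lam (-t) y) := by
  rw [← b.sum_inner_mul_inner, ← b.sum_inner_mul_inner x]
  refine Finset.sum_congr rfl fun l _ => ?_
  rw [inner_flow, ← inner_conj_symm, inner_flow, map_mul, inner_conj_symm, ← Complex.exp_conj,
    map_mul, Complex.conj_ofReal, Complex.conj_I]
  rw [show ((-t * lam l : ℝ) : ℂ) * Complex.I = ((t * lam l : ℝ) : ℂ) * -Complex.I by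
    push_cast; ring]
  ring

theorem flow_neg_flow (t : ℝ) (x : E) : flow b lam (-t) (flow b lam t x) = x := by
  rw [← flow_add, neg_add_cancel, flow_zero]

theorem norm_flow (t : ℝ) (x : E) : ‖flow b lam t x‖ = ‖x‖ := by
  rw [@norm_eq_sqrt_re_inner ℂ, @norm_eq_sqrt_re_inner ℂ, inner_flow_left, flow_neg_flow]

theorem IsBessel.flow {ν : Type*} [Fintype ν] {f : ν → E} (hf : IsBessel f) (t : ℝ) :
    IsBessel fun i => flow b lam t (f i) :=
  hf.map (inner_flow_left b lam t) fun y => (norm_flow b lam (-t) y).le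

/-- In eigencoordinates this is `|e^z - 1 - z| ≤ |z|²` for `|z| ≤ 1`; the choice `h₀ = L⁻¹` ensures
`|z| ≤ 1` for all eigenvalues at once. -/
theorem exists_norm_flow_sub_le {X : E →ₗ[ℂ] E} (hX : ∀ l x, inner ℂ (b l) (X x) =
    (lam l : ℂ) * inner ℂ (b l) x) :
    ∃ C, 0 ≤ C ∧ ∃ h₀ > 0, ∀ h : ℝ, |h| ≤ h₀ → ∀ x : E,
      ‖flow b lam h x - x - (h : ℂ) • Complex.I • X x‖ ≤ C * h ^ 2 * ‖x‖ := by
  obtain ⟨L, hL0, hL⟩ : ∃ L : ℝ, 0 < L ∧ ∀ l, |lam l| ≤ L :=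
    ⟨1 + ∑ l, |lam l|, by positivity, fun l => by
      have := Finset.single_le_sum (f := fun l => |lam l|) (fun _ _ => abs_nonneg _)
        (Finset.mem_univ l)
      linarith⟩
  refine ⟨L ^ 2, by positivity, L⁻¹, by positivity, fun h hh x => ?_⟩
  have h1 : ∀ l, ‖inner ℂ (b l) (flow b lam h x - x - (h : ℂ) • Complex.I • X x)‖ ^ 2 ≤
      (L ^ 2 * h ^ 2) ^ 2 * ‖inner ℂ (b l) x‖ ^ 2 := by
    intro l
    rw [inner_sub_right, inner_sub_right, inner_flow, inner_smul_right, inner_smul_right, hX]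
    set z : ℂ := ((h * lam l : ℝ) : ℂ) * Complex.I with hz
    have h2 : ‖z‖ = |h| * |lam l| := by
      rw [hz, norm_mul, Complex.norm_real, Complex.norm_I, mul_one, Real.norm_eq_abs, abs_mul]
    have h3 : ‖z‖ ≤ 1 := by
      rw [h2]
      calc |h| * |lam l| ≤ L⁻¹ * L := mul_le_mul hh (hL l) (abs_nonneg _) (by positivity)
        _ = 1 := inv_mul_cancel₀ hL0.ne'
    have h4 := Complex.norm_exp_sub_one_sub_id_le h3
    have h5 : ‖z‖ ^ 2 ≤ L ^ 2 * h ^ 2 := by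
      rw [h2, mul_pow, sq_abs, mul_comm]
      exact mul_le_mul_of_nonneg_right (pow_le_pow_left₀ (abs_nonneg _) (hL l) 2) (sq_nonneg _)
    rw [show Complex.exp z * inner ℂ (b l) x - inner ℂ (b l) x -
        (h : ℂ) * (Complex.I * ((lam l : ℂ) * inner ℂ (b l) x)) =
        (Complex.exp z - 1 - z) * inner ℂ (b l) x by rw [hz]; push_cast; ring,
      norm_mul, mul_pow]
    exact mul_le_mul_of_nonneg_right (pow_le_pow_left₀ (norm_nonneg _) (h4.trans h5) 2)
      (by positivity)
  have h2 := Finset.sum_le_sum fun l (_ : l ∈ Finset.univ) => h1 l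
  rw [b.sum_sq_norm_inner_right, ← Finset.mul_sum, b.sum_sq_norm_inner_right, ← mul_pow] at h2
  exact le_of_sq_le_sq h2 (by positivity)

theorem exists_norm_apply_le [FiniteDimensional ℂ E] (A : E →ₗ[ℂ] E) :
    ∃ K, 0 ≤ K ∧ ∀ x, ‖A x‖ ≤ K * ‖x‖ :=
  ⟨‖LinearMap.toContinuousLinearMap A‖, norm_nonneg _, fun x =>
    (LinearMap.toContinuousLinearMap A).le_opNorm x⟩

/-- First and second order expansion of a sesquilinear form along the flow. -/
theorem exists_norm_inner_flow_sub_le [FiniteDimensional ℂ E] {X : E →ₗ[ℂ] E}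
    (hX : ∀ l x, inner ℂ (b l) (X x) = (lam l : ℂ) * inner ℂ (b l) x) (A : E →ₗ[ℂ] E) :
    ∃ C, 0 ≤ C ∧ ∃ h₀ > 0, ∀ h : ℝ, |h| ≤ h₀ → ∀ x y : E,
      ‖inner ℂ (flow b lam h x) (A (flow b lam h y)) - inner ℂ x (A y)‖ ≤ C * |h| * ‖x‖ * ‖y‖ ∧
      ‖inner ℂ (flow b lam h x) (A (flow b lam h y)) - inner ℂ x (A y) -
        (h : ℂ) * (inner ℂ (Complex.I • X x) (A y) + inner ℂ x (A (Complex.I • X y)))‖ ≤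
        C * h ^ 2 * ‖x‖ * ‖y‖ := by
  obtain ⟨C, hC, h₀, hh₀, hflow⟩ := exists_norm_flow_sub_le b lam hX
  obtain ⟨K, hK, hAK⟩ := exists_norm_apply_le A
  obtain ⟨N, hN, hXN⟩ := exists_norm_apply_le X
  set D := C + N with hD
  have hD0 : 0 ≤ D := by positivity
  have hCD : C ≤ D := by linarith
  have hfirst : ∀ h : ℝ, |h| ≤ min h₀ 1 → ∀ x, ‖flow b lam h x - x‖ ≤ D * |h| * ‖x‖ := by
    intro h hh x
    have h1 := hflow h (hh.trans (min_le_left _ _)) x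
    have h2 : ‖(h : ℂ) • Complex.I • X x‖ ≤ |h| * (N * ‖x‖) := by
      rw [norm_smul, norm_smul, Complex.norm_real, Complex.norm_I, one_mul, Real.norm_eq_abs]
      exact mul_le_mul_of_nonneg_left (hXN x) (abs_nonneg _)
    have h3 : h ^ 2 ≤ |h| := by
      rw [← sq_abs]
      nlinarith [abs_nonneg h, hh.trans (min_le_right _ _)]
    have h4 := norm_add_le (flow b lam h x - x - (h : ℂ) • Complex.I • X x)
      ((h : ℂ) • Complex.I • X x)
    rw [sub_add_cancel] at h4
    have h5 : C * h ^ 2 * ‖x‖ ≤ C * |h| * ‖x‖ := by gcongr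
    calc _ ≤ _ := h4
      _ ≤ C * |h| * ‖x‖ + |h| * (N * ‖x‖) := by linarith
      _ = D * |h| * ‖x‖ := by rw [hD]; ring
  refine ⟨K * (2 * D + D ^ 2), by positivity, min h₀ 1, by positivity, fun h hh x y => ?_⟩
  have hdx := hfirst h hh x
  have hdy := hfirst h hh y
  have hex := hflow h (hh.trans (min_le_left _ _)) x
  have hey := hflow h (hh.trans (min_le_left _ _)) y
  set dx := flow b lam h x - x with hdxd
  set dy := flow b lam h y - y with hdyd
  have ex : flow b lam h x = x + dx := by rw [hdxd]; abel
  have ey : flow b lam h y = y + dy := by rw [hdyd]; abel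
  have hquad : ‖inner ℂ dx (A dy)‖ ≤ K * D ^ 2 * h ^ 2 * ‖x‖ * ‖y‖ := by
    calc ‖inner ℂ dx (A dy)‖ ≤ ‖dx‖ * (K * ‖dy‖) :=
          (norm_inner_le_norm _ _).trans (mul_le_mul_of_nonneg_left (hAK _) (norm_nonneg _))
      _ ≤ (D * |h| * ‖x‖) * (K * (D * |h| * ‖y‖)) := by gcongr
      _ = K * D ^ 2 * |h| ^ 2 * ‖x‖ * ‖y‖ := by ring
      _ = _ := by rw [sq_abs]
  -- The increment is exactly bilinear in the displacements `dx`, `dy`; the term in both is already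
  -- of second order.
  have hexp : inner ℂ (flow b lam h x) (A (flow b lam h y)) - inner ℂ x (A y) =
      inner ℂ dx (A y) + inner ℂ x (A dy) + inner ℂ dx (A dy) := by
    rw [ex, ey, map_add A y dy, inner_add_left, inner_add_right x, inner_add_right dx]
    ring
  constructor
  · have h1 : ‖inner ℂ dx (A y)‖ ≤ (D * |h| * ‖x‖) * (K * ‖y‖) :=
      (norm_inner_le_norm _ _).trans (mul_le_mul hdx (hAK _) (norm_nonneg _) (by positivity))
    have h2 : ‖inner ℂ x (A dy)‖ ≤ ‖x‖ * (K * (D * |h| * ‖y‖)) :=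
      (norm_inner_le_norm _ _).trans (mul_le_mul_of_nonneg_left ((hAK _).trans (by gcongr))
        (norm_nonneg _))
    have h3 : h ^ 2 ≤ |h| := by
      rw [← sq_abs]
      nlinarith [abs_nonneg h, hh.trans (min_le_right _ _)]
    have h4 : K * D ^ 2 * h ^ 2 * ‖x‖ * ‖y‖ ≤ K * D ^ 2 * |h| * ‖x‖ * ‖y‖ := by gcongr
    rw [hexp]
    calc _ ≤ ‖inner ℂ dx (A y)‖ + ‖inner ℂ x (A dy)‖ + ‖inner ℂ dx (A dy)‖ := norm_add₃_le
      _ ≤ (D * |h| * ‖x‖) * (K * ‖y‖) + ‖x‖ * (K * (D * |h| * ‖y‖)) +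
          K * D ^ 2 * |h| * ‖x‖ * ‖y‖ := by linarith
      _ = _ := by ring
  · set rx := dx - (h : ℂ) • Complex.I • X x with hrx
    set ry := dy - (h : ℂ) • Complex.I • X y with hry
    have h1 : ‖inner ℂ rx (A y)‖ ≤ (C * h ^ 2 * ‖x‖) * (K * ‖y‖) :=
      (norm_inner_le_norm _ _).trans (mul_le_mul hex (hAK _) (norm_nonneg _) (by positivity))
    have h2 : ‖inner ℂ x (A ry)‖ ≤ ‖x‖ * (K * (C * h ^ 2 * ‖y‖)) :=
      (norm_inner_le_norm _ _).trans (mul_le_mul_of_nonneg_left ((hAK _).trans (by gcongr))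
        (norm_nonneg _))
    have h5 : inner ℂ (flow b lam h x) (A (flow b lam h y)) - inner ℂ x (A y) -
        (h : ℂ) * (inner ℂ (Complex.I • X x) (A y) + inner ℂ x (A (Complex.I • X y))) =
        inner ℂ rx (A y) + inner ℂ x (A ry) + inner ℂ dx (A dy) := by
      have h6 : inner ℂ x (A ry) = inner ℂ x (A dy) -
          (h : ℂ) * inner ℂ x (A (Complex.I • X y)) := by
        rw [hry, map_sub, map_smul A (h : ℂ), inner_sub_right, inner_smul_right _ _ (h : ℂ)]
      have h7 : inner ℂ rx (A y) = inner ℂ dx (A y) -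
          (h : ℂ) * inner ℂ (Complex.I • X x) (A y) := by
        rw [hrx, inner_sub_left, inner_smul_left _ _ (h : ℂ), Complex.conj_ofReal]
      rw [h6, h7, hexp]
      ring
    rw [h5]
    calc _ ≤ ‖inner ℂ rx (A y)‖ + ‖inner ℂ x (A ry)‖ + ‖inner ℂ dx (A dy)‖ := norm_add₃_le
      _ ≤ (C * h ^ 2 * ‖x‖) * (K * ‖y‖) + ‖x‖ * (K * (C * h ^ 2 * ‖y‖)) +
          K * D ^ 2 * h ^ 2 * ‖x‖ * ‖y‖ := by linarith
      _ = K * (2 * C + D ^ 2) * h ^ 2 * ‖x‖ * ‖y‖ := by ring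
      _ ≤ _ := by gcongr

end Flow

/-! ### The matrix exponential as a flow -/

section Exp

variable {ι : Type*} [Fintype ι] [DecidableEq ι]

theorem expI_mulVec_eigenvectorBasis {X : Matrix ι ι ℂ} (hX : X.IsHermitian) (l : ι) :
    expI X *ᵥ ⇑(hX.eigenvectorBasis l) =
      Complex.exp ((hX.eigenvalues l : ℂ) * Complex.I) • ⇑(hX.eigenvectorBasis l) := by
  set U : Matrix ι ι ℂ := (hX.eigenvectorUnitary : Matrix ι ι ℂ) with hU
  have hUU : star U * U = 1 := Unitary.coe_star_mul_self hX.eigenvectorUnitary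
  have hUU' : U * star U = 1 := Unitary.coe_mul_star_self hX.eigenvectorUnitary
  have hinv : U⁻¹ = star U := Matrix.inv_eq_left_inv hUU
  have hunit : IsUnit U := IsUnit.of_mul_eq_one _ hUU'
  set d : ι → ℂ := fun l => (hX.eigenvalues l : ℂ) * Complex.I with hd
  have h1 : Complex.I • X = U * Matrix.diagonal d * U⁻¹ := by
    have h2 : Matrix.diagonal d = Complex.I •
        Matrix.diagonal (RCLike.ofReal ∘ hX.eigenvalues : ι → ℂ) := by
      ext a b
      by_cases hab : a = b
      · subst hab
        simp [hd, mul_comm]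
      · simp [hab]
    conv_lhs => rw [hX.spectral_theorem, Unitary.conjStarAlgAut_apply]
    rw [h2, hinv, Matrix.mul_smul, Matrix.smul_mul]
  have h3 : ⇑(hX.eigenvectorBasis l) = U *ᵥ Pi.single l 1 :=
    (hX.eigenvectorUnitary_mulVec l).symm
  rw [expI, h1, Matrix.exp_conj _ _ hunit, Matrix.exp_diagonal, hinv, h3, Matrix.mulVec_mulVec,
    mul_assoc, hUU, mul_one, ← Matrix.mulVec_mulVec, ← Matrix.mulVec_smul]
  congr 1
  ext a
  by_cases hal : a = l
  · subst hal
    simp [hd, Pi.coe_exp, Complex.exp_eq_exp_ℂ]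
  · simp [hal]

theorem toEuclideanLin_expI {X : Matrix ι ι ℂ} (hX : X.IsHermitian) :
    Matrix.toEuclideanLin (expI X) = flow hX.eigenvectorBasis hX.eigenvalues 1 := by
  refine hX.eigenvectorBasis.toBasis.ext fun l => ?_
  rw [OrthonormalBasis.coe_toBasis]
  refine ext_inner_basis hX.eigenvectorBasis fun a => ?_
  have h1 : Matrix.toEuclideanLin (expI X) (hX.eigenvectorBasis l) =
      Complex.exp ((hX.eigenvalues l : ℂ) * Complex.I) • hX.eigenvectorBasis l := by
    apply (WithLp.ofLp_injective 2)
    simpa [Matrix.toLpLin_apply] using expI_mulVec_eigenvectorBasis hX l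
  rw [inner_flow, h1, inner_smul_right, one_mul]
  by_cases hal : a = l
  · rw [hal]
  · rw [hX.eigenvectorBasis.inner_eq_zero hal, mul_zero, mul_zero]

theorem inner_eigenvectorBasis_toEuclideanLin {X : Matrix ι ι ℂ} (hX : X.IsHermitian) (l : ι)
    (x : EuclideanSpace ℂ ι) :
    inner ℂ (hX.eigenvectorBasis l) (Matrix.toEuclideanLin X x) =
      (hX.eigenvalues l : ℂ) * inner ℂ (hX.eigenvectorBasis l) x := by
  have h1 : Matrix.toEuclideanLin X (hX.eigenvectorBasis l) =
      (hX.eigenvalues l : ℂ) • hX.eigenvectorBasis l := by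
    apply (WithLp.ofLp_injective 2)
    simpa [Matrix.toLpLin_apply] using hX.mulVec_eigenvectorBasis l
  rw [← IsHermitian.inner_toEuclideanLin hX, h1, inner_smul_left, Complex.conj_ofReal]

end Exp

/-! ### Integration of infinitesimal bounds; unitary conjugates -/

/-- Propagation of a bound over the unit interval by small steps. -/
theorem bound_of_small_steps {P : ℝ → ℝ → Prop} (hmono : ∀ t b b', P t b → b ≤ b' → P t b')
    {c C h₀ b₀ : ℝ} (hh₀ : 0 < h₀)
    (hstep : ∀ t h b, 0 < h → h ≤ h₀ → P (t + h) b → P t (b + c * h + C * h ^ 2))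
    (h1 : P 1 b₀) {ε : ℝ} (hε : 0 < ε) : P 0 (b₀ + c + ε) := by
  obtain ⟨N, hN⟩ := exists_nat_gt (max (h₀⁻¹) (|C| / ε))
  have hN0 : (0 : ℝ) < N := (inv_pos.mpr hh₀).trans ((le_max_left _ _).trans_lt hN)
  have hN1 : (N : ℝ)⁻¹ ≤ h₀ := inv_le_of_inv_le₀ hh₀ ((le_max_left _ _).trans hN.le)
  have hN2 : C * (N : ℝ)⁻¹ ≤ ε := by
    have h2 := ((le_max_right _ _).trans hN.le : |C| / ε ≤ N)
    rw [div_le_iff₀ hε] at h2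
    rw [← div_eq_mul_inv, div_le_iff₀ hN0]
    linarith [le_abs_self C]
  -- Backwards from time `1` in steps of length `1/N`. The quadratic errors add up to `C / N ≤ ε`.
  have key : ∀ k : ℕ, P (1 - k * (N : ℝ)⁻¹)
      (b₀ + k * (c * (N : ℝ)⁻¹ + C * (N : ℝ)⁻¹ ^ 2)) := by
    intro k
    induction k with
    | zero => simpa using h1
    | succ k ih =>
      have h2 := hstep (1 - (k + 1 : ℕ) * (N : ℝ)⁻¹) (N : ℝ)⁻¹ _ (inv_pos.mpr hN0) hN1
        (by convert ih using 1; push_cast; ring)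
      convert h2 using 1
      push_cast
      ring
  have h2 := key N
  have h3 : (N : ℝ) * (N : ℝ)⁻¹ = 1 := mul_inv_cancel₀ hN0.ne'
  rw [h3, sub_self] at h2
  refine hmono _ _ _ h2 ?_
  calc b₀ + N * (c * (N : ℝ)⁻¹ + C * (N : ℝ)⁻¹ ^ 2)
      = b₀ + (N * (N : ℝ)⁻¹) * (c + C * (N : ℝ)⁻¹) := by ring
    _ ≤ b₀ + c + ε := by rw [h3]; linarith

section Conjugation

variable {ι : Type*} [Fintype ι] [DecidableEq ι]

/-- The sum is `g 0 - g 1` for `g t = ∑ Re ⟨V_t u, A V_t v⟩`. Moving along the flow keeps the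
families Bessel, so the commutator bound holds with the same constant at every time. -/
theorem sum_re_inner_sub_conj_le {A X : Matrix ι ι ℂ} (hA : A.IsHermitian) (hX : X.IsHermitian)
    {j : ℕ} {u v : Fin j → EuclideanSpace ℂ ι} (hu : IsBessel u) (hv : IsBessel v) :
    ∑ i, (inner ℂ (u i)
      (Matrix.toEuclideanLin (A - (expI X)ᴴ * A * expI X) (v i))).re ≤
      prefixSum j (entrywiseMul (singVals X) (sprPos (directSum_isHermitian hA hA))) := by
  set c := prefixSum j (entrywiseMul (singVals X) (sprPos (directSum_isHermitian hA hA)))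
  set V := flow hX.eigenvectorBasis hX.eigenvalues
  set T := Matrix.toEuclideanLin A with hT
  obtain ⟨C, hC, h₀, hh₀, hflow⟩ := exists_norm_inner_flow_sub_le hX.eigenvectorBasis
    hX.eigenvalues (inner_eigenvectorBasis_toEuclideanLin hX) T
  set g : ℝ → ℝ := fun t => ∑ i, (inner ℂ (V t (u i)) (T (V t (v i)))).re with hg
  have hstep : ∀ t h b, 0 < h → h ≤ h₀ → g (t + h) ≤ b → g t ≤ b + c * h + (j * C) * h ^ 2 := by
    intro t h b h0 h1 hb
    have hu' : IsBessel fun i => V t (u i) := hu.flow _ _ t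
    have hv' : IsBessel fun i => V t (v i) := hv.flow _ _ t
    -- The factor `i` from differentiating `e^{itX}` is moved into the first family, which stays
    -- Bessel.
    have hcomm := sum_re_inner_commutator_le hA hA X
      (hu'.const_smul (c := Complex.I) (by simp)) hv'
    have h2 : ∀ i, (inner ℂ (V t (u i)) (T (V t (v i)))).re -
        (inner ℂ (V (t + h) (u i)) (T (V (t + h) (v i)))).re ≤
        h * (inner ℂ (Complex.I • V t (u i))
          (Matrix.toEuclideanLin (A * X - X * A) (V t (v i)))).re + C * h ^ 2 := by
      intro i
      have h3 := (hflow h (by rwa [abs_of_pos h0]) (V t (u i)) (V t (v i))).2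
      rw [← flow_add, ← flow_add, add_comm h t] at h3
      have h4 := (Complex.abs_re_le_norm _).trans h3
      have h5 : C * h ^ 2 * ‖V t (u i)‖ * ‖V t (v i)‖ ≤ C * h ^ 2 := by
        have h6 : ‖V t (u i)‖ * ‖V t (v i)‖ ≤ 1 :=
          mul_le_one₀ (hu'.norm_le_one i) (norm_nonneg _) (hv'.norm_le_one i)
        rw [mul_assoc]
        exact mul_le_of_le_one_right (by positivity) h6
      have h6 := neg_le_of_abs_le (h4.trans h5)
      rw [Complex.sub_re, Complex.sub_re, Complex.re_ofReal_mul] at h6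
      have h7 : (inner ℂ (Complex.I • Matrix.toEuclideanLin X (V t (u i))) (T (V t (v i))) +
          inner ℂ (V t (u i)) (T (Complex.I • Matrix.toEuclideanLin X (V t (v i))))).re =
          -(inner ℂ (Complex.I • V t (u i))
            (Matrix.toEuclideanLin (A * X - X * A) (V t (v i)))).re := by
        rw [map_sub, LinearMap.sub_apply, toEuclideanLin_mul_apply, toEuclideanLin_mul_apply,
          map_smul, inner_smul_left, inner_smul_right, inner_smul_left, inner_sub_right,
          IsHermitian.inner_toEuclideanLin hX, Complex.conj_I, ← Complex.neg_re]
        congr 1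
        ring
      rw [h7] at h6
      linarith
    have h3 := Finset.sum_le_sum fun i (_ : i ∈ Finset.univ) => h2 i
    rw [Finset.sum_sub_distrib, Finset.sum_add_distrib, ← Finset.mul_sum] at h3
    simp only [Finset.sum_const, Finset.card_univ, Fintype.card_fin, nsmul_eq_mul] at h3
    have h4 := mul_le_mul_of_nonneg_left hcomm h0.le
    simp only [hg] at hb ⊢
    linarith
  have hle : ∀ ε > 0, g 0 ≤ g 1 + c + ε := fun ε hε =>
    bound_of_small_steps (P := fun t b => g t ≤ b) (fun _ _ _ h h' => h.trans h') hh₀ hstep le_rfl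
      hε
  have hfin := le_of_forall_pos_le_add hle
  have h1 : ∑ i, (inner ℂ (u i)
      (Matrix.toEuclideanLin (A - (expI X)ᴴ * A * expI X) (v i))).re = g 0 - g 1 := by
    simp only [hg]
    rw [← Finset.sum_sub_distrib]
    refine Finset.sum_congr rfl fun i _ => ?_
    simp only [V]
    rw [flow_zero, flow_zero, ← toEuclideanLin_expI hX, inner_toEuclideanLin_left, map_sub,
      LinearMap.sub_apply, toEuclideanLin_mul_apply, toEuclideanLin_mul_apply, inner_sub_right,
      Complex.sub_re]
  rw [h1]
  linarith

theorem submajorized_sub_conj {A X : Matrix ι ι ℂ} (hA : A.IsHermitian) (hX : X.IsHermitian) :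
    Submajorized (singVals (A - (expI X)ᴴ * A * expI X))
      (entrywiseMul (singVals X) (sprPos (directSum_isHermitian hA hA))) :=
  submajorized_of_finset
    (antitone_entrywiseMul (antitone_singVals X) (antitone_sprPos _) (singVals_nonneg X)
      (sprPos_nonneg _))
    (fun _ => mul_nonneg (singVals_nonneg X _) (sprPos_nonneg _ _)) fun s =>
    sum_singularValues_le_of_isBessel _ finrank_euclideanSpace s fun _ _ hu hv =>
      sum_re_inner_sub_conj_le hA hX hu hv

end Conjugation

/-! ### A regularized arccosine and a Peierls inequality -/

/-- Factors the derivative of `arccos (r v)`, up to sign, into the two normalizations later used for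
the `±1` eigenvectors of the reflection. -/
theorem sqrt_div_mul_sqrt_div_eq {r v : ℝ} (h0 : 0 < r) (h1 : r < 1) (hv : v ∈ Set.Icc (-1 : ℝ) 1) :
    √(r / (1 + r * v)) * √(r / (1 - r * v)) = r / √(1 - (r * v) ^ 2) := by
  have h2 : 0 < 1 + r * v := by nlinarith [hv.1, hv.2]
  have h3 : 0 < 1 - r * v := by nlinarith [hv.1, hv.2]
  rw [← Real.sqrt_mul (by positivity), div_mul_div_comm, Real.sqrt_div (by positivity),
    Real.sqrt_mul_self h0.le]
  congr 2
  ring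

/-- A quadratic minorant of `v ↦ arccos (r v) / 2`, uniform in the base point. -/
theorem exists_arccos_quadratic_minorant {r : ℝ} (h0 : 0 < r) (h1 : r < 1) :
    ∃ K, 0 ≤ K ∧ ∀ v₀ ∈ Set.Icc (-1 : ℝ) 1, ∀ v ∈ Set.Icc (-1 : ℝ) 1,
      Real.arccos (r * v₀) / 2 +
        (-(√(r / (1 + r * v₀)) * √(r / (1 - r * v₀))) / 2) * (v - v₀) - K * (v - v₀) ^ 2 ≤
        Real.arccos (r * v) / 2 := by
  set m := √(1 - r ^ 2) with hm
  have hr2 : 0 < 1 - r ^ 2 := by nlinarith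
  have hm0 : 0 < m := Real.sqrt_pos.mpr hr2
  have hle : ∀ v ∈ Set.Icc (-1 : ℝ) 1, 1 - r ^ 2 ≤ 1 - (r * v) ^ 2 := by
    intro v hv
    have : v ^ 2 ≤ 1 := by nlinarith [hv.1, hv.2]
    nlinarith [sq_nonneg r]
  have hmle : ∀ v ∈ Set.Icc (-1 : ℝ) 1, m ≤ √(1 - (r * v) ^ 2) := fun v hv =>
    Real.sqrt_le_sqrt (hle v hv)
  have hnonneg : ∀ v ∈ Set.Icc (-1 : ℝ) 1, 0 ≤ 1 - (r * v) ^ 2 := fun v hv =>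
    hr2.le.trans (hle v hv)
  -- `m` bounds `√(1 - (r v)²)` from below on `[-1, 1]`. The derivative of `arccos (r v) / 2` is
  -- then Lipschitz with constant `m⁻³`, and the mean value inequality is applied after subtracting
  -- the tangent at `v₀`.
  refine ⟨(m ^ 3)⁻¹, by positivity, fun v₀ hv₀ v hv => ?_⟩
  rw [sqrt_div_mul_sqrt_div_eq h0 h1 hv₀]
  set p := r / √(1 - (r * v₀) ^ 2) with hp
  have hsub : Set.uIcc v₀ v ⊆ Set.Icc (-1 : ℝ) 1 := Set.uIcc_subset_Icc hv₀ hv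
  have hder : ∀ w ∈ Set.uIcc v₀ v, HasDerivWithinAt
      (fun w => Real.arccos (r * w) / 2 + p / 2 * w)
      (-(1 / √(1 - (r * w) ^ 2)) * r / 2 + p / 2) (Set.uIcc v₀ v) w := by
    intro w hw
    have hw' := hsub hw
    have h2 : r * w ≠ -1 := by nlinarith [hw'.1, hw'.2]
    have h3 : r * w ≠ 1 := by nlinarith [hw'.1, hw'.2]
    have h4 : HasDerivAt (fun w => r * w) r w := by
      simpa using (hasDerivAt_id w).const_mul r
    have h5 := (Real.hasDerivAt_arccos h2 h3).comp w h4
    have h6 : HasDerivAt (fun w => p / 2 * w) (p / 2) w := by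
      simpa using (hasDerivAt_id w).const_mul (p / 2)
    exact ((h5.div_const 2).add h6).hasDerivWithinAt
  have hbound : ∀ w ∈ Set.uIcc v₀ v,
      ‖-(1 / √(1 - (r * w) ^ 2)) * r / 2 + p / 2‖ ≤ (m ^ 3)⁻¹ * |v - v₀| := by
    intro w hw
    have hw' := hsub hw
    have hA := hmle w hw'
    have hB := hmle v₀ hv₀
    have hA2 : √(1 - (r * w) ^ 2) ^ 2 = 1 - (r * w) ^ 2 :=
      Real.sq_sqrt (hnonneg w hw')
    have hB2 : √(1 - (r * v₀) ^ 2) ^ 2 = 1 - (r * v₀) ^ 2 :=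
      Real.sq_sqrt (hnonneg v₀ hv₀)
    rw [hp]
    set A := √(1 - (r * w) ^ 2)
    set B := √(1 - (r * v₀) ^ 2)
    have hA0 : 0 < A := hm0.trans_le hA
    have hB0 : 0 < B := hm0.trans_le hB
    have e1 : -(1 / A) * r / 2 + r / B / 2 =
        r / 2 * (r ^ 2 * (v₀ + w) * (v₀ - w)) / (A * B * (A + B)) := by
      have : r ^ 2 * (v₀ + w) * (v₀ - w) = (A - B) * (A + B) := by
        ring_nf
        rw [hA2, hB2]
        ring
      rw [this]
      field_simp
      ring
    rw [e1, Real.norm_eq_abs, abs_div, abs_of_pos (by positivity : 0 < A * B * (A + B)),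
      div_le_iff₀ (by positivity)]
    have h2 : |w - v₀| ≤ |v - v₀| := Set.abs_sub_left_of_mem_uIcc hw
    have h3 : m ^ 3 * 2 ≤ A * B * (A + B) := by
      calc m ^ 3 * 2 = m * m * (m + m) := by ring
        _ ≤ A * B * (A + B) := by gcongr
    have h4 : |v₀ + w| ≤ 2 := abs_le.mpr ⟨by linarith [hv₀.1, hw'.1], by linarith [hv₀.2, hw'.2]⟩
    have h5 : |r / 2 * (r ^ 2 * (v₀ + w) * (v₀ - w))| ≤ |v - v₀| := by
      rw [abs_mul, abs_mul, abs_mul, abs_of_pos (by positivity : 0 < r / 2), abs_sq,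
        abs_sub_comm v₀ w]
      calc r / 2 * (r ^ 2 * |v₀ + w| * |w - v₀|) ≤ 1 / 2 * (1 ^ 2 * 2 * |v - v₀|) := by gcongr
        _ = |v - v₀| := by ring
    calc _ ≤ |v - v₀| := h5
      _ = (m ^ 3)⁻¹ * |v - v₀| * m ^ 3 := by field_simp
      _ ≤ (m ^ 3)⁻¹ * |v - v₀| * (A * B * (A + B)) := by
          gcongr
          nlinarith [pow_pos hm0 3]
  have h2 := Convex.norm_image_sub_le_of_norm_hasDerivWithin_le hder hbound (convex_uIcc v₀ v)
    Set.left_mem_uIcc Set.right_mem_uIcc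
  rw [Real.norm_eq_abs, Real.norm_eq_abs, mul_assoc, ← sq, sq_abs] at h2
  have h3 := (abs_le.mp h2).1
  linarith

section Peierls

variable {F : Type*} [NormedAddCommGroup F] [InnerProductSpace ℂ F] [FiniteDimensional ℂ F]

/-- A Peierls type inequality for functions with a quadratic minorant. -/
theorem exists_finset_sum_le_sum_eigenvalues {H : F →ₗ[ℂ] F} (hH : H.IsSymmetric) {k : ℕ}
    (hk : Module.finrank ℂ F = k) (hev : ∀ m, hH.eigenvalues hk m ∈ Set.Icc (-1 : ℝ) 1) {j : ℕ}
    {x : Fin j → F} (hx : Orthonormal ℂ x) {φ : ℝ → ℝ} {u p : Fin j → ℝ} {K : ℝ}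
    (hφ : ∀ i, ∀ v ∈ Set.Icc (-1 : ℝ) 1, φ (u i) + p i * (v - u i) - K * (v - u i) ^ 2 ≤ φ v) :
    ∃ s : Finset (Fin k), s.card = j ∧
      ∑ i, (φ (u i) + p i * ((inner ℂ (x i) (H (x i))).re - u i) -
        K * ‖H (x i) - (u i : ℂ) • x i‖ ^ 2) ≤ ∑ m ∈ s, φ (hH.eigenvalues hk m) := by
  set w := hH.eigenvectorBasis hk
  set μ := hH.eigenvalues hk
  -- Rows sum to `1`, so the minorant can be averaged over the eigenvalues. Column sums are at most
  -- `1`, so the resulting weighted sum is bounded by one over `j` eigenvalues.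
  set D : Fin j → Fin k → ℝ := fun i m => ‖inner ℂ (x i) (w m)‖ ^ 2 with hD
  have hD1 : ∀ i, ∑ m, D i m = 1 := by
    intro i
    rw [w.sum_sq_norm_inner_left, hx.1 i, one_pow]
  have hDH : ∀ i, ∑ m, D i m * μ m = (inner ℂ (x i) (H (x i))).re := by
    intro i
    rw [re_inner_apply_self_eq_sum hH hk]
    exact Finset.sum_congr rfl fun m _ => mul_comm _ _
  have hDsq : ∀ i, ∑ m, D i m * (μ m - u i) ^ 2 = ‖H (x i) - (u i : ℂ) • x i‖ ^ 2 := by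
    intro i
    rw [← w.sum_sq_norm_inner_left]
    refine Finset.sum_congr rfl fun m _ => ?_
    rw [inner_sub_left, hH, hH.apply_eigenvectorBasis, inner_smul_right, inner_smul_left,
      Complex.conj_ofReal, ← sub_mul, norm_mul, mul_pow]
    simp only [Complex.coe_algebraMap]
    rw [← Complex.ofReal_sub, Complex.norm_real, Real.norm_eq_abs, sq_abs, mul_comm]
  obtain ⟨s, hs, hle⟩ := exists_finset_sum_mul_le (j := j) (fun m => φ (μ m))
    (fun m => ∑ i, D i m) (fun m => Finset.sum_nonneg fun i _ => by positivity)
    (fun m => by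
      have := Orthonormal.isBessel hx (w m)
      rwa [w.norm_eq_one, one_pow] at this)
    (by rw [Finset.sum_comm]; simp [hD1])
  refine ⟨s, hs, le_trans ?_ hle⟩
  simp only [Finset.sum_mul]
  rw [Finset.sum_comm]
  refine Finset.sum_le_sum fun i _ => ?_
  calc φ (u i) + p i * ((inner ℂ (x i) (H (x i))).re - u i) - K * ‖H (x i) - (u i : ℂ) • x i‖ ^ 2
      = ∑ m, D i m * (φ (u i) + p i * (μ m - u i) - K * (μ m - u i) ^ 2) := by
        have e1 : ∀ m, D i m * (φ (u i) + p i * (μ m - u i) - K * (μ m - u i) ^ 2) =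
            D i m * (φ (u i) - p i * u i) + p i * (D i m * μ m) -
              K * (D i m * (μ m - u i) ^ 2) := fun m => by ring
        simp only [e1, Finset.sum_sub_distrib, Finset.sum_add_distrib]
        rw [← Finset.sum_mul, ← Finset.mul_sum, ← Finset.mul_sum, hD1, hDH, hDsq]
        ring
    _ ≤ ∑ m, D i m * φ (μ m) := Finset.sum_le_sum fun m _ =>
        mul_le_mul_of_nonneg_left (hφ i _ (hev m)) (by positivity)

end Peierls

/-! ### Reflections, compressions and principal angles -/

section Reflection

variable {ι : Type*} [Fintype ι] [DecidableEq ι]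

/-- The first variation of the angles is controlled by the spectral spread. -/
theorem sum_im_inner_le_prefixSum_sprPos {X : Matrix ι ι ℂ} (hX : X.IsHermitian)
    {R : EuclideanSpace ℂ ι →ₗ[ℂ] EuclideanSpace ℂ ι} (hR : R.IsSymmetric)
    (hRR : ∀ x, R (R x) = x) {j : ℕ} {a : Fin j → EuclideanSpace ℂ ι} (ha : Orthonormal ℂ a)
    {u : Fin j → ℝ} (hau : ∀ l i, inner ℂ (a l) (R (a i)) = (u i : ℂ) * inner ℂ (a l) (a i))
    (hu : ∀ i, u i ∈ Set.Icc (-1 : ℝ) 1) {r : ℝ} (hr0 : 0 < r) (hr1 : r < 1) :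
    ∑ i, √(r / (1 + r * u i)) * √(r / (1 - r * u i)) *
      (inner ℂ (a i + R (a i)) (Matrix.toEuclideanLin X (a i - R (a i)))).im ≤
      prefixSum j (sprPos hX) := by
  set T := Matrix.toEuclideanLin X
  have hTs : ∀ x y, inner ℂ (T x) y = inner ℂ x (T y) := IsHermitian.inner_toEuclideanLin hX
  set y : Fin j → EuclideanSpace ℂ ι := fun i => a i + R (a i) with hy
  set z : Fin j → EuclideanSpace ℂ ι := fun i => a i - R (a i) with hz
  have hRa : ∀ l i, inner ℂ (R (a l)) (a i) = inner ℂ (a l) (R (a i)) := fun l i => hR _ _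
  have hRRa : ∀ l i, inner ℂ (R (a l)) (R (a i)) = inner ℂ (a l) (a i) := fun l i => by
    rw [hR, hRR]
  have hyy : ∀ l i, inner ℂ (y l) (y i) = 2 * (1 + (u i : ℂ)) * inner ℂ (a l) (a i) := by
    intro l i
    simp only [hy, inner_add_left, inner_add_right, hRa, hRRa, hau]
    ring
  have hzz : ∀ l i, inner ℂ (z l) (z i) = 2 * (1 - (u i : ℂ)) * inner ℂ (a l) (a i) := by
    intro l i
    simp only [hz, inner_sub_left, inner_sub_right, hRa, hRRa, hau]
    ring
  have hyz : ∀ l i, inner ℂ (y l) (z i) = 0 := by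
    intro l i
    simp only [hz, hy, inner_add_left, inner_sub_right, hRa, hRRa]
    ring
  have hzy : ∀ l i, inner ℂ (z l) (y i) = 0 := by
    intro l i
    rw [← inner_conj_symm, hyz, map_zero]
  have hny : ∀ i, ‖y i‖ ^ 2 = 2 * (1 + u i) := by
    intro i
    have h1 := hyy i i
    rw [inner_self_eq_norm_sq_to_K, inner_self_eq_norm_sq_to_K, ha.1 i] at h1
    apply Complex.ofReal_injective
    simpa using h1
  have hnz : ∀ i, ‖z i‖ ^ 2 = 2 * (1 - u i) := by
    intro i
    have h1 := hzz i i
    rw [inner_self_eq_norm_sq_to_K, inner_self_eq_norm_sq_to_K, ha.1 i] at h1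
    apply Complex.ofReal_injective
    simpa using h1
  set α : Fin j → ℝ := fun i => √(r / (1 + r * u i)) with hα
  set β : Fin j → ℝ := fun i => √(r / (1 - r * u i)) with hβ
  have hpos : ∀ i, 0 < 1 + r * u i ∧ 0 < 1 - r * u i := fun i =>
    ⟨by nlinarith [(hu i).1, (hu i).2], by nlinarith [(hu i).1, (hu i).2]⟩
  -- `y i` and `z i` are mutually orthogonal and `R` acts on them by `1` and `-1`. With `c = ∓i` the
  -- two quadratic forms differ by the imaginary part of `⟨y, X z⟩`, weighted by `α β`. The
  -- normalization keeps the squared norm at most `1`, as a mean of two ratios that are at most `1`.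
  set f : ℂ → Fin j → EuclideanSpace ℂ ι := fun c i =>
    (((α i / 2 : ℝ) : ℂ) • y i + (c * ((β i / 2 : ℝ) : ℂ)) • z i) with hf
  have hff : ∀ c l i, inner ℂ (f c l) (f c i) =
      (((α l / 2 : ℝ) : ℂ) * ((α i / 2 : ℝ) : ℂ)) * inner ℂ (y l) (y i) +
      ((starRingEnd ℂ c * c) * (((β l / 2 : ℝ) : ℂ) * ((β i / 2 : ℝ) : ℂ))) *
        inner ℂ (z l) (z i) := by
    intro c l i
    simp only [hf, inner_add_left, inner_add_right, inner_smul_left, inner_smul_right, hyz, hzy,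
      map_mul, Complex.conj_ofReal]
    ring
  have hnf : ∀ c, ‖c‖ = 1 → ∀ i, ‖f c i‖ ^ 2 =
      r * (1 + u i) / (1 + r * u i) / 2 + r * (1 - u i) / (1 - r * u i) / 2 := by
    intro c hc i
    have h1 : ‖f c i‖ ^ 2 = ‖((α i / 2 : ℝ) : ℂ) • y i‖ ^ 2 +
        ‖(c * ((β i / 2 : ℝ) : ℂ)) • z i‖ ^ 2 := by
      simp only [hf, norm_sq_add_eq, inner_smul_left, inner_smul_right, hyz]
      simp
    rw [h1, norm_smul, norm_smul, norm_mul, hc, mul_pow, mul_pow, hny, hnz, Complex.norm_real,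
      Complex.norm_real, one_mul, Real.norm_eq_abs, Real.norm_eq_abs, sq_abs, sq_abs, div_pow,
      div_pow, hα, hβ, Real.sq_sqrt (div_pos hr0 (hpos i).1).le,
      Real.sq_sqrt (div_pos hr0 (hpos i).2).le]
    have := (hpos i).1.ne'
    have := (hpos i).2.ne'
    field_simp
  have hbessel : ∀ c, ‖c‖ = 1 → IsBessel (f c) := by
    intro c hc
    refine isBessel_of_orthogonal (fun l i hli => ?_) fun i => ?_
    · rw [hff, hyy, hzz, ha.2 hli]
      ring
    · have h1 : r * (1 + u i) / (1 + r * u i) ≤ 1 := (div_le_one (hpos i).1).mpr (by linarith)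
      have h2 : r * (1 - u i) / (1 - r * u i) ≤ 1 := (div_le_one (hpos i).2).mpr (by linarith)
      have h3 := hnf c hc i
      refine le_of_sq_le_sq ?_ zero_le_one
      linarith
  have key := sum_re_inner_sub_le_prefixSum_sprPos hX (hbessel (-Complex.I) (by simp))
    (hbessel Complex.I (by simp))
    (Finset.sum_congr rfl fun i _ => by rw [hnf _ (by simp), hnf _ (by simp)])
  rw [← Finset.sum_sub_distrib] at key
  refine le_trans (le_of_eq (Finset.sum_congr rfl fun i _ => ?_)) key
  have e1 : inner ℂ (z i) (T (y i)) = (starRingEnd ℂ) (inner ℂ (y i) (T (z i))) := by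
    rw [inner_conj_symm, hTs]
  change _ = (inner ℂ (f (-Complex.I) i) (T (f (-Complex.I) i))).re -
    (inner ℂ (f Complex.I i) (T (f Complex.I i))).re
  rw [← Complex.sub_re]
  have e2 : inner ℂ (f (-Complex.I) i) (T (f (-Complex.I) i)) -
      inner ℂ (f Complex.I i) (T (f Complex.I i)) =
      ((α i * β i / 2 : ℝ) : ℂ) *
        (Complex.I * ((starRingEnd ℂ) (inner ℂ (y i) (T (z i))) - inner ℂ (y i) (T (z i)))) := by
    simp only [hf, map_add, map_smul, inner_add_left, inner_add_right, inner_smul_left,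
      inner_smul_right, e1, map_mul, map_neg, Complex.conj_I, Complex.conj_ofReal]
    push_cast
    ring
  rw [e2, Complex.re_ofReal_mul, Complex.I_mul_re, Complex.sub_im, Complex.conj_im]
  ring

end Reflection

theorem arccos_two_mul_sq_sub_one {σ : ℝ} (h0 : 0 ≤ σ) (h1 : σ ≤ 1) :
    Real.arccos (2 * σ ^ 2 - 1) / 2 = Real.arccos σ := by
  have h2 : Real.cos (2 * Real.arccos σ) = 2 * σ ^ 2 - 1 := by
    rw [Real.cos_two_mul, Real.cos_arccos (by linarith) h1]
  rw [← h2, Real.arccos_cos (by linarith [Real.arccos_nonneg σ])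
    (by linarith [Real.arccos_le_pi_div_two.mpr h0])]
  ring

section Reflection

variable {E : Type*} [NormedAddCommGroup E] [InnerProductSpace ℂ E]

theorem norm_apply_of_involutive {R : E →ₗ[ℂ] E} (hR : R.IsSymmetric) (hRR : ∀ x, R (R x) = x)
    (x : E) : ‖R x‖ = ‖x‖ := by
  rw [@norm_eq_sqrt_re_inner ℂ, @norm_eq_sqrt_re_inner ℂ _ _ _ _ x, hR, hRR]

/-- An orthonormal family in `T` that diagonalizes the compression of `R` to `T`. -/
def IsDiagonalFamily (T : Submodule ℂ E) (R : E →ₗ[ℂ] E) {j : ℕ} (x : Fin j → E)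
    (u : Fin j → ℝ) : Prop :=
  (∀ i, x i ∈ T) ∧ Orthonormal ℂ x ∧ ∀ i, ∀ y ∈ T, inner ℂ y (R (x i)) = (u i : ℂ) * inner ℂ y (x i)

theorem IsDiagonalFamily.inner_self {T : Submodule ℂ E} {R : E →ₗ[ℂ] E} {j : ℕ} {x : Fin j → E}
    {u : Fin j → ℝ} (h : IsDiagonalFamily T R x u) (i : Fin j) :
    inner ℂ (x i) (R (x i)) = (u i : ℂ) := by
  rw [h.2.2 i _ (h.1 i), inner_self_eq_norm_sq_to_K, h.2.1.1 i]
  simp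

theorem IsDiagonalFamily.mem_Icc {T : Submodule ℂ E} {R : E →ₗ[ℂ] E} {j : ℕ} {x : Fin j → E}
    {u : Fin j → ℝ} (h : IsDiagonalFamily T R x u) (hR : R.IsSymmetric)
    (hRR : ∀ x, R (R x) = x) (i : Fin j) : u i ∈ Set.Icc (-1 : ℝ) 1 := by
  have h1 := norm_inner_le_norm (𝕜 := ℂ) (x i) (R (x i))
  rw [h.inner_self, norm_apply_of_involutive hR hRR, h.2.1.1 i, Complex.norm_real,
    Real.norm_eq_abs, one_mul] at h1
  exact abs_le.mp h1

variable [FiniteDimensional ℂ E]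

/-- The compression of a linear map to a subspace. -/
def compression (T : Submodule ℂ E) (R : E →ₗ[ℂ] E) : T →ₗ[ℂ] T :=
  LinearMap.adjoint T.subtype ∘ₗ R ∘ₗ T.subtype

theorem inner_compression (T : Submodule ℂ E) (R : E →ₗ[ℂ] E) (x y : T) :
    inner ℂ x (compression T R y) = inner ℂ (x : E) (R y) := by
  simp only [compression, LinearMap.comp_apply, LinearMap.adjoint_inner_right,
    Submodule.subtype_apply]

theorem norm_compression_sub_le {T : Submodule ℂ E} {R : E →ₗ[ℂ] E} {x : T} {z : ℂ} {c : ℝ}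
    (hc : 0 ≤ c) (h : ∀ y ∈ T, ‖inner ℂ y (R x) - z * inner ℂ y (x : E)‖ ≤ c * ‖y‖) :
    ‖compression T R x - z • x‖ ≤ c := by
  set d := compression T R x - z • x with hd
  have h1 : inner ℂ d d = inner ℂ (d : E) (R x) - z * inner ℂ (d : E) (x : E) := by
    nth_rewrite 2 [hd]
    rw [inner_sub_right, inner_compression, inner_smul_right]
    rfl
  have h2 := h d d.2
  rw [← h1, inner_self_eq_norm_sq_to_K, norm_pow] at h2
  simp only [Complex.coe_algebraMap, Complex.norm_real, norm_norm] at h2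
  have h3 : ‖(d : E)‖ = ‖d‖ := rfl
  rw [h3] at h2
  by_contra! hc'
  nlinarith

theorem isSymmetric_compression (T : Submodule ℂ E) {R : E →ₗ[ℂ] E} (hR : R.IsSymmetric) :
    (compression T R).IsSymmetric := by
  intro x y
  rw [inner_compression, ← inner_conj_symm, inner_compression, inner_conj_symm, hR]

theorem isDiagonalFamily_eigenvectorBasis (T : Submodule ℂ E) {R : E →ₗ[ℂ] E}
    (hR : R.IsSymmetric) {k : ℕ} (hk : Module.finrank ℂ T = k) {j : ℕ} {e : Fin j → Fin k}
    (he : Function.Injective e) :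
    IsDiagonalFamily T R
      (fun i => ((isSymmetric_compression T hR).eigenvectorBasis hk (e i) : E))
      (fun i => (isSymmetric_compression T hR).eigenvalues hk (e i)) := by
  set w := (isSymmetric_compression T hR).eigenvectorBasis hk
  refine ⟨fun i => (w (e i)).2, ?_, fun i y hy => ?_⟩
  · exact (w.orthonormal.comp e he).comp_linearIsometry T.subtypeₗᵢ
  · have h1 := inner_compression T R ⟨y, hy⟩ (w (e i))
    rw [(isSymmetric_compression T hR).apply_eigenvectorBasis, inner_smul_right] at h1
    exact h1.symm

/-- The reflection fixing a subspace. -/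
def reflectionMap (S : Submodule ℂ E) : E →ₗ[ℂ] E :=
  (2 : ℂ) • (S.subtype ∘ₗ LinearMap.adjoint S.subtype) - LinearMap.id

theorem adjoint_subtype_coe (S : Submodule ℂ E) (s : S) :
    LinearMap.adjoint S.subtype (s : E) = s :=
  ext_inner_left ℂ fun v => by rw [LinearMap.adjoint_inner_right]; rfl

theorem reflectionMap_apply (S : Submodule ℂ E) (x : E) :
    reflectionMap S x = (2 : ℂ) • (LinearMap.adjoint S.subtype x : E) - x := rfl

theorem reflectionMap_of_mem {S : Submodule ℂ E} {x : E} (hx : x ∈ S) :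
    reflectionMap S x = x := by
  have := adjoint_subtype_coe S ⟨x, hx⟩
  rw [reflectionMap_apply, this, two_smul, add_sub_cancel_right]

theorem reflectionMap_reflectionMap (S : Submodule ℂ E) (x : E) :
    reflectionMap S (reflectionMap S x) = x := by
  rw [reflectionMap_apply S x, map_sub, map_smul, reflectionMap_of_mem (Subtype.prop _),
    reflectionMap_apply]
  abel

theorem inner_reflectionMap (S : Submodule ℂ E) (x y : E) :
    inner ℂ x (reflectionMap S y) =
      2 * inner ℂ (LinearMap.adjoint S.subtype x) (LinearMap.adjoint S.subtype y) -
        inner ℂ x y := by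
  rw [reflectionMap_apply, inner_sub_right, inner_smul_right, LinearMap.adjoint_inner_left,
    Submodule.subtype_apply]

theorem isSymmetric_reflectionMap (S : Submodule ℂ E) : (reflectionMap S).IsSymmetric := by
  intro x y
  rw [inner_reflectionMap, ← inner_conj_symm, inner_reflectionMap, map_sub, map_mul,
    inner_conj_symm, inner_conj_symm, map_ofNat]

/-- The orthogonal projection onto `S`, restricted to `T`. -/
def angleMap (S T : Submodule ℂ E) : T →ₗ[ℂ] S :=
  LinearMap.adjoint S.subtype ∘ₗ T.subtype

/-- Right singular vectors of the projection from `T` to `S` diagonalize the compressed reflection,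
with eigenvalue `2 σ² - 1`. For `σ = cos θ` this is `cos 2θ`. -/
theorem exists_isDiagonalFamily_arccos (S T : Submodule ℂ E) {k : ℕ}
    (hk : Module.finrank ℂ T = k) {j : ℕ} {e : Fin j → Fin k} (he : Function.Injective e) :
    ∃ x u, IsDiagonalFamily T (reflectionMap S) x u ∧
      ∀ i, Real.arccos ((angleMap S T).singularValues (e i)) = Real.arccos (u i) / 2 := by
  obtain ⟨v, -, -, -, -, hv⟩ := exists_singularValueDecomposition (angleMap S T) hk
  have h : IsDiagonalFamily T (reflectionMap S) (fun i => (v (e i) : E))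
      (fun i => 2 * (angleMap S T).singularValues (e i) ^ 2 - 1) := by
    refine ⟨fun i => (v (e i)).2, (v.orthonormal.comp e he).comp_linearIsometry T.subtypeₗᵢ,
      fun i y hy => ?_⟩
    have h1 : inner ℂ (LinearMap.adjoint S.subtype y)
        (LinearMap.adjoint S.subtype (v (e i) : E)) =
        (((angleMap S T).singularValues (e i) ^ 2 : ℝ) : ℂ) * inner ℂ y (v (e i) : E) :=
      hv ⟨y, hy⟩ (e i)
    rw [inner_reflectionMap, h1]
    push_cast
    ring
  refine ⟨_, _, h, fun i => ?_⟩
  have h2 := (h.mem_Icc (isSymmetric_reflectionMap S) (reflectionMap_reflectionMap S) i).2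
  have h3 := (angleMap S T).singularValues_nonneg (e i)
  exact (arccos_two_mul_sq_sub_one h3 (by nlinarith)).symm

end Reflection

/-! ### Propagation of the angle bound -/

section Angles

variable {ι : Type*} [Fintype ι] [DecidableEq ι]

/-- The eigenvectors at time `t` serve as trial vectors for the compression at time `t + h`. The
Peierls inequality then bounds the sum at `t` by one over eigenvalues at `t + h`, plus the first
variation and a quadratic error. No eigenvector needs to depend smoothly on time. -/
theorem isDiagonalFamily_step {X : Matrix ι ι ℂ} (hX : X.IsHermitian)
    (T : Submodule ℂ (EuclideanSpace ℂ ι))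
    {R : EuclideanSpace ℂ ι →ₗ[ℂ] EuclideanSpace ℂ ι} (hR : R.IsSymmetric)
    (hRR : ∀ x, R (R x) = x) {r : ℝ} (hr0 : 0 < r) (hr1 : r < 1) (j : ℕ)
    {V : ℝ → EuclideanSpace ℂ ι →ₗ[ℂ] EuclideanSpace ℂ ι}
    (hV : V = flow hX.eigenvectorBasis hX.eigenvalues) :
    ∃ C, ∃ h₀ > 0, ∀ t h b : ℝ, 0 < h → h ≤ h₀ →
      (∀ (x : Fin j → EuclideanSpace ℂ ι) (u : Fin j → ℝ),
        IsDiagonalFamily T (V (t + h) ∘ₗ R ∘ₗ V (-(t + h))) x u →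
          ∑ i, Real.arccos (r * u i) / 2 ≤ b) →
      ∀ (x : Fin j → EuclideanSpace ℂ ι) (u : Fin j → ℝ),
        IsDiagonalFamily T (V t ∘ₗ R ∘ₗ V (-t)) x u →
          ∑ i, Real.arccos (r * u i) / 2 ≤ b + prefixSum j (sprPos hX) / 2 * h + C * h ^ 2 := by
  obtain ⟨C, hC, h₀, hh₀, hflow⟩ := exists_norm_inner_flow_sub_le hX.eigenvectorBasis
    hX.eigenvalues (inner_eigenvectorBasis_toEuclideanLin hX) R
  obtain ⟨K, hK, hquad⟩ := exists_arccos_quadratic_minorant hr0 hr1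
  rw [← hV] at hflow
  have hVl : ∀ t x y, inner ℂ (V t x) y = inner ℂ x (V (-t) y) := fun t x y => by
    rw [hV, inner_flow_left]
  have hVn : ∀ t x, ‖V t x‖ = ‖x‖ := fun t x => by rw [hV, norm_flow]
  have hVV : ∀ t x, V t (V (-t) x) = x := fun t x => by
    rw [hV, ← flow_add, add_neg_cancel, flow_zero]
  have hVV' : ∀ t x, V (-t) (V t x) = x := fun t x => by rw [hV, flow_neg_flow]
  have hVadd : ∀ s t x, V (s + t) x = V s (V t x) := fun s t x => by rw [hV, flow_add]
  have hRts : ∀ t, (V t ∘ₗ R ∘ₗ V (-t)).IsSymmetric := by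
    intro t x y
    simp only [LinearMap.comp_apply]
    rw [hVl, hR, ← inner_conj_symm, ← hVl, inner_conj_symm]
  have hRtRt : ∀ t x, (V t ∘ₗ R ∘ₗ V (-t)) ((V t ∘ₗ R ∘ₗ V (-t)) x) = x := by
    intro t x
    simp only [LinearMap.comp_apply]
    rw [hVV', hRR, hVV]
  have hin : ∀ t x y, inner ℂ x ((V t ∘ₗ R ∘ₗ V (-t)) y) = inner ℂ (V (-t) x) (R (V (-t) y)) := by
    intro t x y
    simp only [LinearMap.comp_apply]
    rw [hVl, neg_neg]
  -- Per vector, the first error is the second order remainder of the eigenvalue times the maximal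
  -- slope `r / (1 - r) / 2`. The second is the quadratic defect `K ‖H x - u x‖²`, where the norm is
  -- at most `C h`.
  refine ⟨j * (r / (1 - r) / 2 * C + K * C ^ 2), h₀, hh₀, fun t h b h0 h1 hb x u hxu => ?_⟩
  have hu := hxu.mem_Icc (hRts t) (hRtRt t)
  have hH := isSymmetric_compression T (hRts (t + h))
  set H := compression T (V (t + h) ∘ₗ R ∘ₗ V (-(t + h)))
  set a : Fin j → EuclideanSpace ℂ ι := fun i => V (-t) (x i) with ha
  have hao : Orthonormal ℂ a := by
    refine ⟨fun i => by rw [ha, hVn, hxu.2.1.1], fun l i hli => ?_⟩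
    change inner ℂ (V (-t) (x l)) (V (-t) (x i)) = 0
    rw [hVl, neg_neg, hVV, hxu.2.1.2 hli]
  have hshift : ∀ y, V (-(t + h)) y = V (-h) (V (-t) y) := fun y => by
    rw [← hVadd]; congr 2; ring
  set x' : Fin j → T := fun i => ⟨x i, hxu.1 i⟩ with hx'
  have hx'o : Orthonormal ℂ x' :=
    ⟨fun i => hxu.2.1.1 i, fun l i hli => hxu.2.1.2 hli⟩
  have hh : |(-h)| ≤ h₀ := by rwa [abs_neg, abs_of_pos h0]
  set α : Fin j → ℝ := fun i => √(r / (1 + r * u i)) * √(r / (1 - r * u i)) with hα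
  obtain ⟨s, hs, hle⟩ := exists_finset_sum_le_sum_eigenvalues hH rfl
    -- A single eigenvector, viewed as a family of length one, shows that its eigenvalue lies in
    -- `[-1, 1]`.
    (fun m => (isDiagonalFamily_eigenvectorBasis T (hRts (t + h)) rfl
      (e := fun _ : Fin 1 => m) (fun _ _ _ => Subsingleton.elim _ _)).mem_Icc (hRts _)
      (hRtRt _) 0)
    hx'o (φ := fun v => Real.arccos (r * v) / 2) (u := u) (p := fun i => -α i / 2)
    (fun i v hv => hquad (u i) (hu i) v hv)
  have hsb : ∑ m ∈ s, Real.arccos (r * hH.eigenvalues rfl m) / 2 ≤ b := by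
    have he : Function.Injective (s.orderEmbOfFin hs) := (s.orderEmbOfFin hs).injective
    refine le_trans (le_of_eq ?_)
      (hb _ _ (isDiagonalFamily_eigenvectorBasis T (hRts (t + h)) rfl he))
    rw [← Finset.sum_image (s := Finset.univ) (g := s.orderEmbOfFin hs)
      (f := fun m => Real.arccos (r * hH.eigenvalues rfl m) / 2) (fun a _ b _ h => he h),
      Finset.image_orderEmbOfFin_univ]
  have hvar := sum_im_inner_le_prefixSum_sprPos hX hR hRR hao (u := u) (fun l i => by
    rw [ha, ← hin, hxu.2.2 i _ (hxu.1 l), hVl, neg_neg, hVV]) hu hr0 hr1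
  have hα0 : ∀ i, 0 ≤ α i := fun i => by positivity
  have hαM : ∀ i, α i ≤ r / (1 - r) := by
    intro i
    have h2 : 0 < 1 - r := by linarith
    rw [← Real.mul_self_sqrt (div_pos hr0 h2).le]
    refine mul_le_mul (Real.sqrt_le_sqrt ?_) (Real.sqrt_le_sqrt ?_) (Real.sqrt_nonneg _)
      (Real.sqrt_nonneg _)
    · exact div_le_div_of_nonneg_left hr0.le h2 (by nlinarith [(hu i).1])
    · exact div_le_div_of_nonneg_left hr0.le h2 (by nlinarith [(hu i).2])
  have hG : ∀ i, (inner ℂ (x' i) (H (x' i))).re - u i ≤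
      h * (inner ℂ (a i + R (a i)) (Matrix.toEuclideanLin X (a i - R (a i)))).im + C * h ^ 2 := by
    intro i
    have h2 := (hflow (-h) hh (a i) (a i)).2
    have h3 : inner ℂ (a i) (R (a i)) = (u i : ℂ) := by
      rw [ha, ← hin, hxu.inner_self]
    have h4 : inner ℂ (x' i) (H (x' i)) = inner ℂ (V (-h) (a i)) (R (V (-h) (a i))) := by
      rw [inner_compression, hin, hshift]
    rw [← h4, h3, hao.1 i, mul_one, mul_one] at h2
    have h5 := (le_abs_self _).trans ((Complex.abs_re_le_norm _).trans h2)
    rw [Complex.sub_re, Complex.sub_re, Complex.re_ofReal_mul, Complex.ofReal_re, neg_sq] at h5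
    have hXs := IsHermitian.inner_toEuclideanLin hX
    have h6 : (inner ℂ (Complex.I • Matrix.toEuclideanLin X (a i)) (R (a i)) +
        inner ℂ (a i) (R (Complex.I • Matrix.toEuclideanLin X (a i)))).re =
        -(inner ℂ (a i + R (a i)) (Matrix.toEuclideanLin X (a i - R (a i)))).im := by
      have hreal : ∀ y, (inner ℂ y (Matrix.toEuclideanLin X y)).im = 0 := by
        intro y
        rw [← Complex.conj_eq_iff_im, inner_conj_symm, hXs]
      have e1 : inner ℂ (Matrix.toEuclideanLin X (a i)) (R (a i)) =
          (starRingEnd ℂ) (inner ℂ (R (a i)) (Matrix.toEuclideanLin X (a i))) :=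
        (inner_conj_symm _ _).symm
      rw [map_sub, inner_add_left, inner_sub_right, inner_sub_right, ← hXs (a i) (R (a i)),
        map_smul, inner_smul_left, inner_smul_right, ← hR (a i), e1]
      simp only [Complex.add_re, Complex.add_im, Complex.sub_im, Complex.conj_I, hreal,
        Complex.mul_re, Complex.neg_re, Complex.neg_im, Complex.I_re, Complex.I_im,
        Complex.conj_im, Complex.conj_re]
      ring
    rw [h6] at h5
    linarith
  have hdist : ∀ i, ‖H (x' i) - (u i : ℂ) • x' i‖ ^ 2 ≤ C ^ 2 * h ^ 2 := by
    intro i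
    have h4 : ‖H (x' i) - (u i : ℂ) • x' i‖ ≤ C * h := by
      refine norm_compression_sub_le (by positivity) fun y hy => ?_
      have h3 := (hflow (-h) hh (V (-t) y) (a i)).1
      rw [hao.1 i, hVn, abs_neg, abs_of_pos h0, mul_one] at h3
      rw [hin, hshift, hshift, ← hxu.2.2 i y hy, hin t]
      exact h3
    rw [← mul_pow]
    exact pow_le_pow_left₀ (norm_nonneg _) h4 2
  have hterm : ∀ i, Real.arccos (r * u i) / 2 -
      (α i * (inner ℂ (a i + R (a i)) (Matrix.toEuclideanLin X (a i - R (a i)))).im) * (h / 2) -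
      (r / (1 - r) / 2 * C + K * C ^ 2) * h ^ 2 ≤
      Real.arccos (r * u i) / 2 + -α i / 2 * ((inner ℂ (x' i) (H (x' i))).re - u i) -
        K * ‖H (x' i) - (u i : ℂ) • x' i‖ ^ 2 := by
    intro i
    have h2 := mul_le_mul_of_nonneg_left (hG i) (hα0 i)
    have h3 := mul_le_mul_of_nonneg_left (hdist i) hK
    have h4 := mul_le_mul_of_nonneg_right (hαM i) (by positivity : 0 ≤ C * h ^ 2)
    linarith
  have hsum := (Finset.sum_le_sum fun i (_ : i ∈ Finset.univ) => hterm i).trans (hle.trans hsb)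
  rw [Finset.sum_sub_distrib, Finset.sum_sub_distrib, ← Finset.sum_mul] at hsum
  simp only [Finset.sum_const, Finset.card_univ, Fintype.card_fin, nsmul_eq_mul] at hsum
  have h2 := mul_le_mul_of_nonneg_right hvar (by positivity : 0 ≤ h / 2)
  simp only [hα] at hsum
  linarith

theorem sum_arccos_le_of_isDiagonalFamily {X : Matrix ι ι ℂ} (hX : X.IsHermitian)
    {S T : Submodule ℂ (EuclideanSpace ℂ ι)}
    (hST : S.map (Matrix.toEuclideanLin (expI X)) = T) {j : ℕ}
    {x : Fin j → EuclideanSpace ℂ ι} {u : Fin j → ℝ}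
    (hxu : IsDiagonalFamily T (reflectionMap S) x u) :
    ∑ i, Real.arccos (u i) / 2 ≤ prefixSum j (sprPos hX) / 2 := by
  set V := flow hX.eigenvectorBasis hX.eigenvalues with hV
  rw [toEuclideanLin_expI hX] at hST
  set R := reflectionMap S
  have hr : ∀ r : ℝ, 0 < r → r < 1 → ∑ i, Real.arccos (r * u i) / 2 ≤
      j * (Real.arccos r / 2) + prefixSum j (sprPos hX) / 2 := by
    intro r hr0 hr1
    obtain ⟨C, h₀, hh₀, hstep⟩ := isDiagonalFamily_step hX T (isSymmetric_reflectionMap S)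
      (reflectionMap_reflectionMap S) hr0 hr1 j hV
    refine le_of_forall_pos_le_add fun ε hε => ?_
    have h2 := bound_of_small_steps
      (P := fun t b => ∀ (x : Fin j → EuclideanSpace ℂ ι) (u : Fin j → ℝ),
        IsDiagonalFamily T (V t ∘ₗ R ∘ₗ V (-t)) x u → ∑ i, Real.arccos (r * u i) / 2 ≤ b)
      (fun t b b' h hbb' x u hxu => (h x u hxu).trans hbb') hh₀ hstep
      (b₀ := j * (Real.arccos r / 2)) (fun x u hxu => by
        -- At time `1` the transported reflection fixes `e^{iX} S = T` pointwise. The starting value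
        -- is thus `j * arccos r / 2`, which vanishes as `r → 1`.
        have h3 : ∀ i, u i = 1 := by
          intro i
          have h4 := hxu.inner_self i
          obtain ⟨y, hy, hyx⟩ : x i ∈ S.map (V 1) := by rw [hST]; exact hxu.1 i
          have h5 : V (-1) (x i) = y := by rw [← hyx, hV, flow_neg_flow]
          have h6 : (V 1 ∘ₗ R ∘ₗ V (-1)) (x i) = x i := by
            simp only [LinearMap.comp_apply, h5]
            rw [reflectionMap_of_mem hy, hyx]
          rw [h6, inner_self_eq_norm_sq_to_K, hxu.2.1.1 i] at h4
          apply Complex.ofReal_injective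
          simpa using h4.symm
        simp [h3]) hε
    refine h2 x u ?_
    have h3 : V 0 ∘ₗ R ∘ₗ V (-0) = R := by
      ext1 y
      simp only [LinearMap.comp_apply, neg_zero, hV, flow_zero]
    rwa [h3]
  have hlim : Filter.Tendsto (fun r : ℝ => ∑ i, Real.arccos (r * u i) / 2)
      (nhdsWithin 1 (Set.Iio 1)) (nhds (∑ i, Real.arccos (1 * u i) / 2)) := by
    refine tendsto_nhdsWithin_of_tendsto_nhds (Continuous.tendsto ?_ 1)
    have := Real.continuous_arccos
    fun_prop
  have hlim' : Filter.Tendsto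
      (fun r : ℝ => j * (Real.arccos r / 2) + prefixSum j (sprPos hX) / 2)
      (nhdsWithin 1 (Set.Iio 1))
      (nhds (j * (Real.arccos 1 / 2) + prefixSum j (sprPos hX) / 2)) := by
    refine tendsto_nhdsWithin_of_tendsto_nhds (Continuous.tendsto ?_ 1)
    have := Real.continuous_arccos
    fun_prop
  have := le_of_tendsto_of_tendsto hlim hlim' (by
    filter_upwards [Ioo_mem_nhdsLT (show (0 : ℝ) < 1 by norm_num)] with r hr'
    exact hr r hr'.1 hr'.2)
  simpa using this

theorem submajorized_principalAngles {n : ℕ} {S T : Submodule ℂ (EuclideanSpace ℂ (Fin n))}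
    {X : Matrix (Fin n) (Fin n) ℂ} (hX : X.IsHermitian)
    (hST : S.map (Matrix.toEuclideanLin (expI X)) = T) :
    Submajorized (principalAngles S T) ((1 / 2 : ℝ) • sprPos hX) := by
  refine submajorized_of_finset (fun a b hab => ?_) (fun i => ?_) fun s => ?_
  · simp only [Pi.smul_apply, smul_eq_mul]
    linarith [antitone_sprPos hX hab]
  · simp only [Pi.smul_apply, smul_eq_mul]
    linarith [sprPos_nonneg hX i]
  -- The angles are indexed by the dimension of `S`, but the singular vectors used live in `T`.
  have hk : Module.finrank ℂ T = Module.finrank ℂ S := by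
    rw [← hST, toEuclideanLin_expI hX]
    refine (LinearEquiv.finrank_eq (Submodule.equivMapOfInjective _ ?_ S)).symm
    exact Function.LeftInverse.injective (g := flow hX.eigenvectorBasis hX.eigenvalues (-1))
      (flow_neg_flow _ _ 1)
  -- Reversed, because the largest angle corresponds to the smallest singular value.
  set e : Fin s.card → Fin (Module.finrank ℂ S) := fun i => (s.orderEmbOfFin rfl i).rev
  have hei : Function.Injective e := Fin.rev_injective.comp (s.orderEmbOfFin rfl).injective
  obtain ⟨x, u, hxu, hu⟩ := exists_isDiagonalFamily_arccos S T hk hei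
  have key := sum_arccos_le_of_isDiagonalFamily hX hST hxu
  have h1 : ∑ i ∈ s, principalAngles S T i = ∑ i, Real.arccos (u i) / 2 := by
    have h2 : ∑ i ∈ s, principalAngles S T i =
        ∑ i, principalAngles S T (s.orderEmbOfFin rfl i) := by
      rw [← Finset.sum_image (s := Finset.univ) (g := s.orderEmbOfFin rfl)
        (f := principalAngles S T) (fun a _ b _ h => (s.orderEmbOfFin rfl).injective h),
        Finset.image_orderEmbOfFin_univ]
    rw [h2]
    exact Finset.sum_congr rfl fun i _ => hu i
  rw [prefixSum_smul, h1]
  linarith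

end Angles

end SpectralSpread

end

/-! ### The equivalence -/

theorem theorem3p6 :
    List.TFAE [
      -- 1. differences of Hermitian matrices
      ∀ (n : ℕ) (A₁ A₂ : Matrix (Fin n) (Fin n) ℂ)
        (h₁ : A₁.IsHermitian) (h₂ : A₂.IsHermitian),
        SpectralSpread.Submajorized (SpectralSpread.singVals (A₁ - A₂))
          (SpectralSpread.sprPos (SpectralSpread.directSum_isHermitian h₁ h₂)),
      -- 2. off-diagonal blocks of Hermitian matrices
      ∀ (n : ℕ) (A₁ A₂ B : Matrix (Fin n) (Fin n) ℂ)
        (hA : (Matrix.fromBlocks A₁ B Bᴴ A₂).IsHermitian),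
        SpectralSpread.Submajorized ((2 : ℝ) • SpectralSpread.singVals B)
          (SpectralSpread.sprPos hA),
      -- 3. generalized commutators
      ∀ (n : ℕ) (A₁ A₂ X : Matrix (Fin n) (Fin n) ℂ)
        (h₁ : A₁.IsHermitian) (h₂ : A₂.IsHermitian),
        SpectralSpread.Submajorized (SpectralSpread.singVals (A₁ * X - X * A₂))
          (SpectralSpread.entrywiseMul (SpectralSpread.singVals X)
            (SpectralSpread.sprPos (SpectralSpread.directSum_isHermitian h₁ h₂))),
      -- 4. unitary conjugates
      ∀ (n : ℕ) (A X U : Matrix (Fin n) (Fin n) ℂ)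
        (hA : A.IsHermitian), X.IsHermitian → U = SpectralSpread.expI X →
        SpectralSpread.Submajorized (SpectralSpread.singVals (A - Uᴴ * A * U))
          (SpectralSpread.entrywiseMul (SpectralSpread.singVals X)
            (SpectralSpread.sprPos (SpectralSpread.directSum_isHermitian hA hA))),
      -- 5. principal angles
      ∀ (n : ℕ) (S T : Submodule ℂ (EuclideanSpace ℂ (Fin n)))
        (X : Matrix (Fin n) (Fin n) ℂ) (hX : X.IsHermitian),
        S.map (Matrix.toEuclideanLin (SpectralSpread.expI X)) = T →
        SpectralSpread.Submajorized (SpectralSpread.principalAngles S T)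
          ((1 / 2 : ℝ) • SpectralSpread.sprPos hX)] := by
  -- Statements that all hold are equivalent.
  have tfae_of_forall : ∀ l : List Prop, (∀ p ∈ l, p) → l.TFAE := fun l hl p hp q hq =>
    iff_of_true (hl p hp) (hl q hq)
  refine tfae_of_forall _ fun p hp => ?_
  simp only [List.mem_cons, List.not_mem_nil, or_false] at hp
  rcases hp with rfl | rfl | rfl | rfl | rfl
  · exact fun n A₁ A₂ h₁ h₂ => SpectralSpread.submajorized_sub h₁ h₂
  · exact fun n A₁ A₂ B hA => SpectralSpread.submajorized_offDiagonal hA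
  · exact fun n A₁ A₂ X h₁ h₂ => SpectralSpread.submajorized_commutator h₁ h₂ X
  · rintro n A X _ hA hX rfl
    exact SpectralSpread.submajorized_sub_conj hA hX
  · exact fun n S T X hX hST => SpectralSpread.submajorized_principalAngles hX hST
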